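/- **Setting.** Let $M$ be a smooth Riemannian manifold (Hausdorff, second countable, without boundary), $\mathrm{vol}$ its volume measure, and $m=\rho\,\mathrm{vol}$ with $\rho$ a positive $C^1$ function. For a $C^1$ vector field $W$ put $\operatorname{div}_m W=\rho^{-1}\operatorname{div}(\rho W)$. Let $S$ be a second order differential operator on $M$ with $S1=0$ such that $Sf\in L^2(m)$, $\langle Sf,g\rangle_{L^2(m)}=\langle f,Sg\rangle_{L^2(m)}$ and $\langle Sf,f\rangle_{L^2(m)}\le 0$ for all $f,g\in C_c^\infty(M)$, and let $\Gamma(f,g)=\frac12[S(fg)-fSg-gSf]$. Let $V_0$ be a $C^1$ vector field with $\operatorname{div}_m V_0\ge c_1$ for some $c_1\in\mathbb R$. Put $\alpha_0=-c_1/2$ and, for $f,g\in C_c^\infty(M)$, $$\mathcal E(f,g)=\int_M\Gamma(f,g)\,dm-\langle V_0f,g\rangle_{L^2(m)},\qquad \mathcal E_{\alpha_0+1}(f,g)=\mathcal E(f,g)+(\alpha_0+1)\langle f,g\rangle_{L^2(m)} .$$ A $C^1$ vector field $W$ is said to satisfy the weak sector condition if there is $K<\infty$ with $$|\langle Wf,g\rangle_{L^2(m)}|\le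 K\,\mathcal E_{\alpha_0+1}(f,f)^{1/2}\,\mathcal E_{\alpha_0+1}(g,g)^{1/2}\quad\text{for all } f,g\in C_c^\infty(M).$$ Assume that $V_0$ satisfies it. Let $\mathcal H\subset L^2(m)$ be the domain of the smallest closed extension of $(\mathcal E,C_c^\infty(M))$, i.e. the set of $u\in L^2(m)$ for which some sequence in $C_c^\infty(M)$ is Cauchy for $\mathcal E_{\alpha_0+1}(\cdot,\cdot)^{1/2}$ and converges to $u$ in $L^2(m)$; such a sequence is said to approximate $u$. Let $V$ be a complete $C^1$ vector field on $M$ with flow $(\phi_t)_{t\in\mathbb R}$, such that $m$ is invariant under every $\phi_t$, $V$ satisfies the weak sector condition, and $f\circ\phi_t\in\mathcal H$ for all $f\in C_c^\infty(M)$ and $t\in\mathbb R$. Assume that $M$ is the union of an increasing sequence of compact sets invariant under the flow. Let $\mathcal E^V(f,g)=-\langle Vf,g\rangle_{L^2(m)}$ on $C_c^\infty(M)$, extended by continuity to $\mathcal H\times\mathcal H$: $\mathcal E^V(u,v)=\lim_k\mathcal E^V(f_k,g_k)$ whenever $(f_k)$, $(g_k)$ approximate $u$, $v$. Let $E$ be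 the set of ergodic probability measures of the flow and $\mathcal I$ the $\sigma$-field generated by the invariant Borel sets and the $m$-negligible Borel sets. Let $\widetilde M$ be a locally compact separable metric space, $\pi:M\to\widetilde M$ a continuous map with $\pi\circ\phi_t=\pi$ $m$-a.e. for every $t\in\mathbb R$, and $p:\widetilde M\to E$ a measurable map such that $P:=p\circ\pi$ is a regular conditional probability with respect to $\mathcal I$ and $m$, i.e. for every Borel set $A$ the function $x\mapsto P(x)(A)$ is $\mathcal I$-measurable and $\int_B P(x)(A)\,m(dx)=m(A\cap B)$ for all $B\in\mathcal I$. Put $\widetilde m=\pi_*m$ and $\widetilde{\mathcal H}=\{\widetilde u\in L^2(\widetilde m):\widetilde u\circ\pi\in\mathcal H\}$. **Proposition.** The form $\mathcal E^V$ is well defined on $\mathcal H\times\mathcal H$ (the limit above exists and does not depend on the approximating sequences), and for every $u\in\mathcal H$ the following are equivalent: 1. $u$ is invariant: for every $t\in\mathbb R$, $u\circ\phi_t=u$ $m$-a.e.; 2. there is $\widetilde u\in\widetilde{\mathcal H}$ such that $u=\widetilde u\circ\pi$ $m$-a.e.; 3. $\mathcal E^V(u,v)=0$ for all $v\in\mathcal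 H$. -/

import Mathlib

open MeasureTheory Filter Set
open scoped Manifold ContDiff Topology ENNReal

noncomputable section

namespace FlowForm

/-- The model space `ℝⁿ`. -/
abbrev Euc (n : ℕ) : Type := EuclideanSpace ℝ (Fin n)

/-- The `i`-th vector of the standard basis of `ℝⁿ`. -/
def stdVec {n : ℕ} (i : Fin n) : Euc n := EuclideanSpace.single i (1 : ℝ)

section Manifold

variable {n : ℕ} {M : Type*} [TopologicalSpace M] [ChartedSpace (Euc n) M]

/-- A smooth Riemannian metric on `M`. -/
abbrev Metric (n : ℕ) (M : Type*) [TopologicalSpace M] [ChartedSpace (Euc n) M]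
    [IsManifold 𝓘(ℝ, Euc n) ∞ M] :=
  Bundle.ContMDiffRiemannianMetric 𝓘(ℝ, Euc n) ∞ (Euc n)
    (fun x : M => TangentSpace 𝓘(ℝ, Euc n) x)

/-- The coordinate vector field `∂ᵢ` of the chart at `x₀`, at the point with coordinates `y`. -/
def coordVec (x₀ : M) (i : Fin n) (y : Euc n) :
    TangentSpace 𝓘(ℝ, Euc n) ((chartAt (Euc n) x₀).symm y) :=
  mfderiv 𝓘(ℝ, Euc n) 𝓘(ℝ, Euc n) (chartAt (Euc n) x₀).symm y (stdVec i)

/-- The coordinates, in the chart at `x₀`, of the vector field `V` at the point with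
coordinates `y`. -/
def coordField (V : (x : M) → TangentSpace 𝓘(ℝ, Euc n) x) (x₀ : M) (y : Euc n) : Euc n :=
  mfderiv 𝓘(ℝ, Euc n) 𝓘(ℝ, Euc n) (chartAt (Euc n) x₀) ((chartAt (Euc n) x₀).symm y)
    (V ((chartAt (Euc n) x₀).symm y))

/-- The vector field `V` is of class `C¹`. -/
def IsC1Field [IsManifold 𝓘(ℝ, Euc n) ∞ M] (V : (x : M) → TangentSpace 𝓘(ℝ, Euc n) x) : Prop :=
  ContMDiff 𝓘(ℝ, Euc n) (𝓘(ℝ, Euc n).tangent) 1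
    (fun x => (⟨x, V x⟩ : TangentBundle 𝓘(ℝ, Euc n) M))

/-- The function `V f`, the derivative of `f` along `V`. -/
def along (V : (x : M) → TangentSpace 𝓘(ℝ, Euc n) x) (f : M → ℝ) (x : M) : ℝ :=
  mfderiv 𝓘(ℝ, Euc n) 𝓘(ℝ, ℝ) f x (V x)

/-- `f ∈ C_c^∞(M)`. -/
def IsTest (n : ℕ) {M : Type*} [TopologicalSpace M] [ChartedSpace (Euc n) M] (f : M → ℝ) : Prop :=
  ContMDiff 𝓘(ℝ, Euc n) 𝓘(ℝ, ℝ) ∞ f ∧ HasCompactSupport f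

section Volume

variable [IsManifold 𝓘(ℝ, Euc n) ∞ M]

/-- `√(det (g_{ij}))` in the chart at `x₀`, as a function of the coordinates. -/
def sqrtDet (g : Metric n M) (x₀ : M) (y : Euc n) : ℝ :=
  Real.sqrt (Matrix.det (Matrix.of fun i j : Fin n =>
    g.inner ((chartAt (Euc n) x₀).symm y) (coordVec x₀ i y) (coordVec x₀ j y)))

/-- `vol` is the Riemannian volume measure of `g`: in every chart it is
`√(det (g_{ij})) dy¹ ⋯ dyⁿ`. On a second countable manifold there is exactly one such measure. -/
def IsRiemannianVolume [MeasurableSpace M] (g : Metric n M) (vol : Measure M) : Prop :=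
  ∀ x₀ : M, ∀ A : Set M, MeasurableSet A → A ⊆ (chartAt (Euc n) x₀).source →
    vol A = ∫⁻ y in (chartAt (Euc n) x₀).target ∩ (chartAt (Euc n) x₀).symm ⁻¹' A,
      ENNReal.ofReal (sqrtDet g x₀ y)

/-- The density, in the chart at `x₀` and with respect to Lebesgue measure, of the measure which
has density `ρ` with respect to the Riemannian volume. -/
def localDensity (g : Metric n M) (ρ : M → ℝ) (x₀ : M) (y : Euc n) : ℝ :=
  ρ ((chartAt (Euc n) x₀).symm y) * sqrtDet g x₀ y

/-- `div_m V = ρ⁻¹ div (ρ V)` for `m = ρ vol`, computed in the chart at `x₀` at the point `x` of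
the domain of this chart: `(ρ √g)⁻¹ ∑ᵢ ∂ᵢ (ρ √g Vⁱ)`. -/
def divergence (g : Metric n M) (ρ : M → ℝ) (V : (x : M) → TangentSpace 𝓘(ℝ, Euc n) x)
    (x₀ x : M) : ℝ :=
  (localDensity g ρ x₀ (chartAt (Euc n) x₀ x))⁻¹ *
    ∑ i : Fin n, fderiv ℝ (fun z => localDensity g ρ x₀ z * coordField V x₀ z i)
      (chartAt (Euc n) x₀ x) (stdVec i)

/-- `div_m V ≥ c` on `M`. -/
def DivergenceGe (g : Metric n M) (ρ : M → ℝ) (V : (x : M) → TangentSpace 𝓘(ℝ, Euc n) x)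
    (c : ℝ) : Prop :=
  ∀ x₀ : M, ∀ x ∈ (chartAt (Euc n) x₀).source, c ≤ divergence g ρ V x₀ x

end Volume

/-- `S` is a (scalar, real) differential operator of order at most two on `C^∞(M)`: in every chart
`S f = ∑ aᵢⱼ ∂ᵢ∂ⱼ f + ∑ bᵢ ∂ᵢ f + c f` for some functions `aᵢⱼ`, `bᵢ`, `c`.
Only the values of `S` at smooth functions matter. -/
def IsSecondOrderOperator (n : ℕ) {M : Type*} [TopologicalSpace M] [ChartedSpace (Euc n) M]
    (S : (M → ℝ) → M → ℝ) : Prop :=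
  ∀ x₀ : M, ∃ (a : M → Fin n → Fin n → ℝ) (b : M → Fin n → ℝ) (c : M → ℝ),
    ∀ f : M → ℝ, ContMDiff 𝓘(ℝ, Euc n) 𝓘(ℝ, ℝ) ∞ f → ∀ x ∈ (chartAt (Euc n) x₀).source,
      S f x =
        (∑ i : Fin n, ∑ j : Fin n, a x i j *
          fderiv ℝ (fun z => fderiv ℝ (f ∘ (chartAt (Euc n) x₀).symm) z (stdVec j))
            (chartAt (Euc n) x₀ x) (stdVec i))
        + (∑ i : Fin n, b x i *
          fderiv ℝ (f ∘ (chartAt (Euc n) x₀).symm) (chartAt (Euc n) x₀ x) (stdVec i))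
        + c x * f x

variable [MeasurableSpace M]

/-- `S` is a second order differential operator with `S 1 = 0`, which maps `C_c^∞(M)` to `L²(m)`
and is symmetric and non-positive there. -/
structure IsSymmetricDiffusionOperator (n : ℕ) {M : Type*} [TopologicalSpace M]
    [ChartedSpace (Euc n) M] [MeasurableSpace M] (m : Measure M) (S : (M → ℝ) → M → ℝ) :
    Prop where
  secondOrder : IsSecondOrderOperator n S
  map_one : S (fun _ => 1) = fun _ => 0
  memLp : ∀ f, IsTest n f → MemLp (S f) 2 m
  symmetric : ∀ f g, IsTest n f → IsTest n g → ∫ x, S f x * g x ∂m = ∫ x, f x * S g x ∂m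
  nonpos : ∀ f, IsTest n f → ∫ x, S f x * f x ∂m ≤ 0

/-- The carré du champ operator `Γ(f, g) = (S(fg) - f S g - g S f) / 2`. -/
def carreDuChamp (S : (M → ℝ) → M → ℝ) (f g : M → ℝ) (x : M) : ℝ :=
  (S (fun y => f y * g y) x - f x * S g x - g x * S f x) / 2

/-- `-⟨V f, g⟩_{L²(m)}`: the form `ℰ^V` on `C_c^∞(M)`. -/
def fieldForm (m : Measure M) (V : (x : M) → TangentSpace 𝓘(ℝ, Euc n) x) (f g : M → ℝ) : ℝ :=
  -∫ x, along V f x * g x ∂m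

/-- `ℰ_α(f, g) = ∫ Γ(f, g) dm - ⟨V₀ f, g⟩_{L²(m)} + α ⟨f, g⟩_{L²(m)}` on `C_c^∞(M)`. -/
def energy (m : Measure M) (S : (M → ℝ) → M → ℝ) (V₀ : (x : M) → TangentSpace 𝓘(ℝ, Euc n) x)
    (α : ℝ) (f g : M → ℝ) : ℝ :=
  ∫ x, carreDuChamp S f g x ∂m + fieldForm m V₀ f g + α * ∫ x, f x * g x ∂m

/-- The weak sector condition for the vector field `V`, relative to the form `ℰ_α`. -/
def SectorCondition (m : Measure M) (S : (M → ℝ) → M → ℝ)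
    (V₀ : (x : M) → TangentSpace 𝓘(ℝ, Euc n) x) (α : ℝ)
    (V : (x : M) → TangentSpace 𝓘(ℝ, Euc n) x) : Prop :=
  ∃ K : ℝ, ∀ f g : M → ℝ, IsTest n f → IsTest n g →
    |∫ x, along V f x * g x ∂m| ≤
      K * Real.sqrt (energy m S V₀ α f f) * Real.sqrt (energy m S V₀ α g g)

/-- The sequence `f` in `C_c^∞(M)` converges to `u` in the form domain: it is Cauchy for the norm
`ℰ_α(·, ·)^{1/2}` and converges to `u` in `L²(m)`. -/
structure Approximates (m : Measure M) (S : (M → ℝ) → M → ℝ)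
    (V₀ : (x : M) → TangentSpace 𝓘(ℝ, Euc n) x) (α : ℝ) (f : ℕ → M → ℝ) (u : M → ℝ) : Prop where
  test : ∀ k, IsTest n (f k)
  cauchy : ∀ ε : ℝ, 0 < ε → ∃ N : ℕ, ∀ k ≥ N, ∀ l ≥ N,
    energy m S V₀ α (f k - f l) (f k - f l) < ε
  tendsto : Tendsto (fun k => eLpNorm (f k - u) 2 m) atTop (𝓝 0)

/-- The domain `ℋ` of the smallest closed extension of `(ℰ, C_c^∞(M))`, as a set of functions
(stable under `m`-a.e. equality). Here `ℰ_α` is the form which defines the norm of `ℋ`. -/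
def formDomain (m : Measure M) (S : (M → ℝ) → M → ℝ)
    (V₀ : (x : M) → TangentSpace 𝓘(ℝ, Euc n) x) (α : ℝ) : Set (M → ℝ) :=
  {u | MemLp u 2 m ∧ ∃ f : ℕ → M → ℝ, Approximates m S V₀ α f u}

/-- `c` is the value at `(u, v)` of the extension by continuity to `ℋ × ℋ` of the form
`ℰ^V(f, g) = -⟨V f, g⟩_{L²(m)}` on `C_c^∞(M)`. -/
def HasFormValue (m : Measure M) (S : (M → ℝ) → M → ℝ)
    (V₀ : (x : M) → TangentSpace 𝓘(ℝ, Euc n) x) (α : ℝ)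
    (V : (x : M) → TangentSpace 𝓘(ℝ, Euc n) x) (u v : M → ℝ) (c : ℝ) : Prop :=
  ∀ f g : ℕ → M → ℝ, Approximates m S V₀ α f u → Approximates m S V₀ α g v →
    Tendsto (fun k => fieldForm m V (f k) (g k)) atTop (𝓝 c)

/-- `ℋ̃ = {ũ ∈ L²(π_* m) : ũ ∘ π ∈ ℋ}`. -/
def contractedDomain {M' : Type*} [MeasurableSpace M'] (m : Measure M) (S : (M → ℝ) → M → ℝ)
    (V₀ : (x : M) → TangentSpace 𝓘(ℝ, Euc n) x) (α : ℝ) (π : M → M') : Set (M' → ℝ) :=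
  {w | MemLp w 2 (m.map π) ∧ w ∘ π ∈ formDomain m S V₀ α}

end Manifold

section Ergodic

variable {M : Type*} [TopologicalSpace M] [MeasurableSpace M]

/-- Invariant Borel sets of the flow. -/
def IsInvariantSet (φ : Flow ℝ M) (A : Set M) : Prop :=
  MeasurableSet A ∧ ∀ t : ℝ, φ t ⁻¹' A = A

/-- Invariant measures of the flow. -/
def IsInvariantMeasure (φ : Flow ℝ M) (μ : Measure M) : Prop :=
  ∀ t : ℝ, MeasurePreserving (φ t) μ μ

/-- The set `E` of ergodic probability measures of the flow. -/
def ergodicMeasures (φ : Flow ℝ M) : Set (Measure M) :=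
  {μ | IsProbabilityMeasure μ ∧ IsInvariantMeasure φ μ ∧
    ∀ A : Set M, IsInvariantSet φ A → μ A = 0 ∨ μ A = 1}

/-- The σ-field `𝓘` generated by the invariant Borel sets and the `m`-negligible Borel sets. -/
@[reducible] def invariantSigma (φ : Flow ℝ M) (m : Measure M) : MeasurableSpace M :=
  MeasurableSpace.generateFrom
    ({A | IsInvariantSet φ A} ∪ {N | MeasurableSet N ∧ m N = 0})

/-- `P` is a regular conditional probability with respect to `𝓘` and `m`: `P(x)` is a probability
measure for all `x`, and for all Borel sets `A`, `x ↦ P(x)(A)` is an `𝓘`-measurable version of the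
conditional expectation of `1_A`. -/
def IsRegularConditionalProbability (φ : Flow ℝ M) (m : Measure M) (P : M → Measure M) : Prop :=
  (∀ x, IsProbabilityMeasure (P x)) ∧
  ∀ A : Set M, MeasurableSet A →
    Measurable[invariantSigma φ m] (fun x => P x A) ∧
    ∀ B : Set M, MeasurableSet[invariantSigma φ m] B → ∫⁻ x in B, P x A ∂m = m (A ∩ B)

/-- `u` is `m`-almost invariant. -/
def IsAlmostInvariant (φ : Flow ℝ M) (m : Measure M) (u : M → ℝ) : Prop :=
  ∀ t : ℝ, u ∘ φ t =ᵐ[m] u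

end Ergodic

end FlowForm

end

set_option linter.unusedSectionVars false

/-! Write A for the form ℰ_{α₀+1} on C_c^∞(M). The divergence bound on V₀ gives A(f,f) ≥ ‖f‖², and
the sector condition for V₀ makes A bounded by its own quadratic form. Since A(f,g) = ⟨Tf,g⟩ for an
operator T into L²(m), an A-Cauchy sequence that tends to 0 in L² also tends to 0 for A
(`tendsto_zero_of_closable`). Hence every form bounded by A, in particular ℰ^V, extends to ℋ. No
completion is built: diagonal limits are computed from iterated ones
(`QBounded.tendsto_of_iterated`).

Invariance and annihilation are linked by d/dt ∫ u·(f∘φ_t) dm = ∫ u·((Vf)∘φ_t) dm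
(`hasDerivAt_integral_comp_flow`). As the flow preserves m, V is antisymmetric, and the right-hand
side is ℰ^V(u, f∘φ_t). If u annihilates ℰ^V, the derivative vanishes for all t, so ∫ (u∘φ_t) f = ∫ u
f for every test function f and u is invariant. If u is invariant, the derivative at 0 vanishes, so
ℰ^V(u,·) is zero on test functions and, by continuity, on ℋ.

The level sets of an invariant u lie in 𝓘, so for almost every x the function u equals u(x)
P(x)-almost surely. Thus ũ(y) = ∫ u dp(y) satisfies u = ũ∘π almost everywhere (`exists_factor`).
Conversely ũ∘π is invariant because π is. -/

namespace FlowForm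

/-! ### Forms bounded by a nonnegative, possibly nonsymmetric, quadratic form -/

section Abstract

variable {F : Type*} [AddCommGroup F] [Module ℝ F]

/-- A sequence which is Cauchy for the quadratic form of `A`. -/
def QCauchy (A : F →ₗ[ℝ] F →ₗ[ℝ] ℝ) (f : ℕ → F) : Prop :=
  ∀ ε : ℝ, 0 < ε → ∃ N : ℕ, ∀ k ≥ N, ∀ l ≥ N, A (f k - f l) (f k - f l) < ε

variable {A : F →ₗ[ℝ] F →ₗ[ℝ] ℝ}

/-- Parallelogram identity with the term A(f+g, f+g) ≥ 0 dropped; the cross terms cancel without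
symmetry of A. -/
theorem quadratic_sub_le (hA : ∀ f, 0 ≤ A f f) (f g : F) :
    A (f - g) (f - g) ≤ 2 * A f f + 2 * A g g := by
  have h := hA (f + g)
  simp only [map_add, map_sub, LinearMap.add_apply, LinearMap.sub_apply] at h ⊢
  linarith

theorem QCauchy.bounded (hA : ∀ f, 0 ≤ A f f) {f : ℕ → F} (hf : QCauchy A f) :
    ∃ R : ℝ, 0 < R ∧ ∃ N : ℕ, ∀ k ≥ N, A (f k) (f k) ≤ R := by
  obtain ⟨N, hN⟩ := hf 1 one_pos
  refine ⟨2 * 1 + 2 * A (f N) (f N), by linarith [hA (f N)], N, fun k hk => ?_⟩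
  have h1 := quadratic_sub_le hA (f k - f N) (-f N)
  have h2 := hN k hk N le_rfl
  simp only [sub_neg_eq_add, sub_add_cancel, map_neg, LinearMap.neg_apply, neg_neg] at h1
  linarith

theorem QCauchy.sub (hA : ∀ f, 0 ≤ A f f) {f g : ℕ → F} (hf : QCauchy A f) (hg : QCauchy A g) :
    QCauchy A (f - g) := by
  intro ε hε
  obtain ⟨N, hN⟩ := hf (ε / 4) (by positivity)
  obtain ⟨N', hN'⟩ := hg (ε / 4) (by positivity)
  refine ⟨max N N', fun k hk l hl => ?_⟩
  have h1 := quadratic_sub_le hA (f k - f l) (g k - g l)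
  have h2 := hN k (le_of_max_le_left hk) l (le_of_max_le_left hl)
  have h3 := hN' k (le_of_max_le_right hk) l (le_of_max_le_right hl)
  have h4 : (f - g) k - (f - g) l = f k - f l - (g k - g l) := by
    simp only [Pi.sub_apply]; abel
  rw [h4]
  linarith

/-- A bilinear form is bounded by the seminorm of `A`. -/
def QBounded (A B : F →ₗ[ℝ] F →ₗ[ℝ] ℝ) : Prop :=
  ∃ K : ℝ, ∀ f g, |B f g| ≤ K * Real.sqrt (A f f) * Real.sqrt (A g g)

variable {B : F →ₗ[ℝ] F →ₗ[ℝ] ℝ}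

/-- The bound treats both arguments alike, so estimates for one slot transfer to the other. -/
theorem QBounded.flip (hB : QBounded A B) : QBounded A B.flip := by
  obtain ⟨K, hK⟩ := hB
  refine ⟨K, fun f g => ?_⟩
  rw [LinearMap.flip_apply, mul_right_comm]
  exact hK g f

theorem QBounded.exists_pos (hB : QBounded A B) :
    ∃ K : ℝ, 0 < K ∧ ∀ f g, |B f g| ≤ K * Real.sqrt (A f f) * Real.sqrt (A g g) := by
  obtain ⟨K, hK⟩ := hB
  refine ⟨max K 1, by positivity, fun f g => (hK f g).trans ?_⟩
  gcongr
  exact le_max_left _ _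

/-- Along a bounded sequence, `B` is uniformly small on the tails of a Cauchy sequence. -/
theorem QBounded.uniform_small (hA : ∀ f, 0 ≤ A f f) (hB : QBounded A B) {f : ℕ → F}
    (hf : QCauchy A f) {ε : ℝ} (hε : 0 < ε) :
    ∃ δ : ℝ, 0 < δ ∧ ∃ N : ℕ, ∀ k ≥ N, ∀ h : F, A h h < δ → |B (f k) h| < ε := by
  obtain ⟨K, hK0, hK⟩ := hB.exists_pos
  obtain ⟨R, hR0, N, hN⟩ := hf.bounded hA
  have hR : 0 < Real.sqrt R := Real.sqrt_pos.2 hR0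
  -- The value of δ solves K √R √δ = ε, where R bounds A(f_k, f_k) on the tail.
  refine ⟨(ε / (K * Real.sqrt R)) ^ 2, by positivity, N, fun k hk h hh => ?_⟩
  have h1 : Real.sqrt (A h h) < ε / (K * Real.sqrt R) := by
    rw [Real.sqrt_lt' (by positivity)]; exact hh
  calc |B (f k) h| ≤ K * Real.sqrt (A (f k) (f k)) * Real.sqrt (A h h) := hK _ _
    _ ≤ K * Real.sqrt R * Real.sqrt (A h h) := by gcongr; exact hN k hk
    _ < K * Real.sqrt R * (ε / (K * Real.sqrt R)) := by gcongr
    _ = ε := by field_simp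

theorem QBounded.tendsto_zero_right (hA : ∀ f, 0 ≤ A f f) (hB : QBounded A B) {f h : ℕ → F}
    (hf : QCauchy A f) (hh : Tendsto (fun k => A (h k) (h k)) atTop (𝓝 0)) :
    Tendsto (fun k => B (f k) (h k)) atTop (𝓝 0) := by
  rw [Metric.tendsto_atTop]
  intro ε hε
  obtain ⟨δ, hδ, N, hN⟩ := hB.uniform_small hA hf hε
  obtain ⟨N', hN'⟩ := (hh.eventually_lt_const hδ).exists_forall_of_atTop
  refine ⟨max N N', fun k hk => ?_⟩
  rw [Real.dist_eq, sub_zero]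
  exact hN k (le_of_max_le_left hk) _ (hN' k (le_of_max_le_right hk))

/-- Iterated limits of `B (f k) (g l)` compute the diagonal limit. -/
theorem QBounded.tendsto_of_iterated (hA : ∀ f, 0 ≤ A f f) (hB : QBounded A B) {f g : ℕ → F}
    (hf : QCauchy A f) (hg : QCauchy A g) {a : ℕ → ℝ} {c : ℝ}
    (h1 : ∀ l, Tendsto (fun k => B (f k) (g l)) atTop (𝓝 (a l)))
    (h2 : Tendsto a atTop (𝓝 c)) :
    Tendsto (fun k => B (f k) (g k)) atTop (𝓝 c) := by
  rw [Metric.tendsto_atTop]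
  intro ε hε
  obtain ⟨δ, hδ, N, hN⟩ := hB.uniform_small hA hf (show 0 < ε / 3 by positivity)
  obtain ⟨N₁, hN₁⟩ := hg δ hδ
  obtain ⟨N₂, hN₂⟩ := Metric.tendsto_atTop.1 h2 (ε / 3) (by positivity)
  -- Split B(f_k, g_k) − c as B(f_k, g_k − g_l) + (B(f_k, g_l) − a_l) + (a_l − c). The first term is
  -- small uniformly in k, so l can be fixed before k grows.
  set l := max N₁ N₂
  obtain ⟨N₃, hN₃⟩ := Metric.tendsto_atTop.1 (h1 l) (ε / 3) (by positivity)
  refine ⟨max N (max N₁ N₃), fun k hk => ?_⟩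
  have e1 := hN k (le_of_max_le_left hk) (g k - g l)
    (hN₁ k (le_of_max_le_left (le_of_max_le_right hk)) l (le_max_left _ _))
  have e2 := hN₂ l (le_max_right _ _)
  have e3 := hN₃ k (le_of_max_le_right (le_of_max_le_right hk))
  rw [Real.dist_eq] at e2 e3 ⊢
  rw [map_sub] at e1
  rw [abs_lt] at *
  constructor <;> linarith [e1.1, e1.2, e2.1, e2.2, e3.1, e3.2]

theorem QBounded.exists_tendsto (hA : ∀ f, 0 ≤ A f f) (hB : QBounded A B) {f g : ℕ → F}
    (hf : QCauchy A f) (hg : QCauchy A g) :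
    ∃ c, Tendsto (fun k => B (f k) (g k)) atTop (𝓝 c) := by
  refine cauchySeq_tendsto_of_complete (Metric.cauchySeq_iff.2 fun ε hε => ?_)
  obtain ⟨δ, hδ, N, hN⟩ := hB.uniform_small hA hf (show 0 < ε / 2 by positivity)
  obtain ⟨δ', hδ', N', hN'⟩ := hB.flip.uniform_small hA hg (show 0 < ε / 2 by positivity)
  obtain ⟨N₁, hN₁⟩ := hf δ' hδ'
  obtain ⟨N₂, hN₂⟩ := hg δ hδ
  refine ⟨max (max N N') (max N₁ N₂), fun k hk l hl => ?_⟩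
  simp only [ge_iff_le, max_le_iff] at hk hl
  -- B(f_k, g_k) − B(f_l, g_l) = B(f_l, g_k − g_l) + B(f_k − f_l, g_k).
  have e1 := hN l hl.1.1 (g k - g l) (hN₂ k hk.2.2 l hl.2.2)
  have e2 := hN' k hk.1.2 (f k - f l) (hN₁ k hk.2.1 l hl.2.1)
  simp only [LinearMap.flip_apply, map_sub] at e1 e2
  rw [Real.dist_eq]
  rw [abs_lt] at *
  constructor <;> linarith [e1.1, e1.2, e2.1, e2.2]

/-- A nonnegative form given by an operator and bounded by its own quadratic form is closable. -/
theorem tendsto_zero_of_closable {X : Type*} [NormedAddCommGroup X] [InnerProductSpace ℝ X]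
    (ι T : F →ₗ[ℝ] X) (hT : ∀ f g, A f g = inner ℝ (T f) (ι g)) (hA : ∀ f, 0 ≤ A f f)
    (hAA : QBounded A A) {h : ℕ → F} (hh : QCauchy A h)
    (h0 : Tendsto (fun k => ι (h k)) atTop (𝓝 0)) :
    Tendsto (fun k => A (h k) (h k)) atTop (𝓝 0) := by
  -- For fixed l, A(h_l, h_k) = ⟨T h_l, ι h_k⟩ tends to 0 as k → ∞. The flip is needed because only
  -- the second argument is seen through ι.
  refine hAA.flip.tendsto_of_iterated (a := fun _ => 0) hA hh hh (fun l => ?_) tendsto_const_nhds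
  simp only [LinearMap.flip_apply, hT]
  simpa using (tendsto_const_nhds (x := T (h l))).inner h0

/-- Cauchy-Schwarz for a symmetric nonnegative form. -/
theorem abs_le_sqrt_mul_sqrt (hA : ∀ f, 0 ≤ A f f) (hs : ∀ f g, A f g = A g f) (f g : F) :
    |A f g| ≤ Real.sqrt (A f f) * Real.sqrt (A g g) := by
  rw [← Real.sqrt_mul (hA f)]
  refine Real.abs_le_sqrt ?_
  -- The polynomial x ↦ A(xg + f, xg + f) is nonnegative, so its discriminant is at most 0.
  have h : ∀ x : ℝ, 0 ≤ A g g * (x * x) + (2 * A f g) * x + A f f := fun x => by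
    have := hA (x • g + f)
    simp only [map_add, map_smul, LinearMap.add_apply, LinearMap.smul_apply, smul_eq_mul,
      hs g f] at this
    linarith
  have := discrim_le_zero h
  rw [discrim] at this
  linarith

end Abstract

/-! ### Metric, density and vector fields in coordinates -/

theorem dotProduct_mulVec_gram {ι E : Type*} [Fintype ι] [TopologicalSpace E] [AddCommGroup E]
    [Module ℝ E] (G : E →L[ℝ] E →L[ℝ] ℝ) (w : ι → E) (v : ι → ℝ) :
    star v ⬝ᵥ (Matrix.of fun i j => G (w i) (w j)).mulVec v = G (∑ i, v i • w i) (∑ i, v i • w i) := by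
  simp only [map_sum, map_smul, sum_apply, smul_apply,
    dotProduct, Matrix.mulVec, Matrix.of_apply, star_trivial, smul_eq_mul, Finset.mul_sum]
  rw [Finset.sum_comm]
  refine Finset.sum_congr rfl fun i _ => Finset.sum_congr rfl fun j _ => ?_
  ring

section Chart

variable {n : ℕ} {M : Type*} [TopologicalSpace M] [ChartedSpace (Euc n) M]

theorem IsTest.continuous {f : M → ℝ} (hf : IsTest n f) : Continuous f := hf.1.continuous

theorem IsTest.mdifferentiableAt {f : M → ℝ} (hf : IsTest n f) (x : M) :
    MDifferentiableAt 𝓘(ℝ, Euc n) 𝓘(ℝ, ℝ) f x := hf.1.mdifferentiable (by simp) x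

variable [IsManifold 𝓘(ℝ, Euc n) ∞ M]

theorem contMDiff_const_section (v : Euc n) :
    ContMDiff 𝓘(ℝ, Euc n) (𝓘(ℝ, Euc n).tangent) 1
      (fun y => (⟨y, v⟩ : TangentBundle 𝓘(ℝ, Euc n) (Euc n))) := by
  have := (contMDiff_vectorSpace_iff_contDiff (𝕜 := ℝ) (n := 1)
    (V := fun y : Euc n => (v : TangentSpace 𝓘(ℝ, Euc n) y))).2 contDiff_const
  exact this

/-- The coordinate field is the tangent map of the inverse chart applied to a constant section. -/
theorem contMDiffOn_coordVec (x₀ : M) (i : Fin n) :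
    haveI : IsManifold 𝓘(ℝ, Euc n) 1 M := IsManifold.of_le (n := ∞) (by norm_cast)
    ContMDiffOn 𝓘(ℝ, Euc n) (𝓘(ℝ, Euc n).tangent) 1
      (fun y => (⟨(chartAt (Euc n) x₀).symm y, coordVec x₀ i y⟩ : TangentBundle 𝓘(ℝ, Euc n) M))
      (chartAt (Euc n) x₀).target := by
  have : IsManifold 𝓘(ℝ, Euc n) 1 M := IsManifold.of_le (n := ∞) (by simp)
  have hsymm : ContMDiffOn 𝓘(ℝ, Euc n) 𝓘(ℝ, Euc n) ∞ (chartAt (Euc n) x₀).symm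
    (chartAt (Euc n) x₀).target := contMDiffOn_chart_symm
  have hopen := (chartAt (Euc n) x₀).open_target
  have h := hsymm.contMDiffOn_tangentMapWithin (m := 1) (by norm_cast)
    hopen.uniqueMDiffOn
  have h2 := h.comp (s := (chartAt (Euc n) x₀).target)
    (contMDiff_const_section (stdVec i)).contMDiffOn (fun y hy => hy)
  refine h2.congr fun y hy => ?_
  simp only [Function.comp, tangentMapWithin, coordVec]
  rw [mfderivWithin_of_isOpen hopen hy]

theorem contDiffOn_metric (g : Metric n M) (x₀ : M) (i j : Fin n) :
    ContDiffOn ℝ 1 (fun y => g.inner ((chartAt (Euc n) x₀).symm y) (coordVec x₀ i y)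
      (coordVec x₀ j y)) (chartAt (Euc n) x₀).target := by
  have : IsManifold 𝓘(ℝ, Euc n) 1 M := IsManifold.of_le (n := ∞) (by simp)
  have hsymm : ContMDiffOn 𝓘(ℝ, Euc n) 𝓘(ℝ, Euc n) 1 (chartAt (Euc n) x₀).symm
    (chartAt (Euc n) x₀).target := contMDiffOn_chart_symm.of_le (m := 1) (n := ∞) (by simp)
  rw [← contMDiffOn_iff_contDiffOn]
  intro y hy
  have h := ContMDiffWithinAt.clm_bundle_apply₂ (F₁ := Euc n) (F₂ := Euc n) (F₃ := ℝ)
    (E₃ := Bundle.Trivial M ℝ)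
    (((g.contMDiff.of_le (m := 1) (by simp)).contMDiffAt).comp_contMDiffWithinAt y (hsymm y hy))
    (contMDiffOn_coordVec x₀ i y hy) (contMDiffOn_coordVec x₀ j y hy)
  simp only [Bundle.contMDiffWithinAt_totalSpace] at h
  exact h.2

/-- The Gram matrix evaluated at v is the squared g-length of the image of v under the derivative of
the inverse chart, and that derivative is injective. -/
theorem metric_posDef (g : Metric n M) (x₀ : M) {y : Euc n}
    (hy : y ∈ (chartAt (Euc n) x₀).target) :
    (Matrix.of fun i j : Fin n => g.inner ((chartAt (Euc n) x₀).symm y) (coordVec x₀ i y)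
      (coordVec x₀ j y)).PosDef := by
  have : IsManifold 𝓘(ℝ, Euc n) 1 M := IsManifold.of_le (n := ∞) (by simp)
  refine Matrix.PosDef.of_dotProduct_mulVec_pos ?_ fun v hv => ?_
  · ext i j
    simp [g.symm]
  set L := mfderiv 𝓘(ℝ, Euc n) 𝓘(ℝ, Euc n) (chartAt (Euc n) x₀).symm y with hL
  have hinj : Function.Injective L :=
    (mdifferentiable_chart (I := 𝓘(ℝ, Euc n)) x₀).symm.mfderiv_injective hy
  have hsum : ∑ i, v i • coordVec x₀ i y = L (WithLp.toLp 2 v : Euc n) := by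
    have : (WithLp.toLp 2 v : Euc n) = ∑ i, v i • (stdVec i : Euc n) := by
      ext k
      simp [stdVec, Finset.sum_apply, Pi.single_apply]
    rw [this]
    erw [map_sum]
    refine Finset.sum_congr rfl fun i _ => ?_
    erw [map_smul]
    rfl
  have hne : ∑ i, v i • coordVec x₀ i y ≠ 0 := by
    rw [hsum]
    intro h0
    have h1 : (WithLp.toLp 2 v : Euc n) = 0 := hinj (h0.trans (map_zero L).symm)
    apply hv
    funext i
    exact congrArg (fun w : Euc n => w i) h1
  have hpos := g.pos _ _ hne
  rw [dotProduct_mulVec_gram (g.inner ((chartAt (Euc n) x₀).symm y))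
    (fun i => coordVec x₀ i y) v]
  exact hpos

theorem sqrtDet_pos (g : Metric n M) (x₀ : M) {y : Euc n}
    (hy : y ∈ (chartAt (Euc n) x₀).target) : 0 < sqrtDet g x₀ y :=
  Real.sqrt_pos.2 (metric_posDef g x₀ hy).det_pos

theorem contDiffOn_sqrtDet (g : Metric n M) (x₀ : M) :
    ContDiffOn ℝ 1 (sqrtDet g x₀) (chartAt (Euc n) x₀).target := by
  unfold sqrtDet
  refine ContDiffOn.sqrt ?_ fun y hy => (metric_posDef g x₀ hy).det_pos.ne'
  simp only [Matrix.det_apply]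
  refine ContDiffOn.sum fun σ _ => ContDiffOn.const_smul _ (contDiffOn_prod fun i _ => ?_)
  exact contDiffOn_metric g x₀ _ _

theorem contDiffOn_localDensity (g : Metric n M) {ρ : M → ℝ}
    (hρ : ContMDiff 𝓘(ℝ, Euc n) 𝓘(ℝ, ℝ) 1 ρ) (x₀ : M) :
    ContDiffOn ℝ 1 (localDensity g ρ x₀) (chartAt (Euc n) x₀).target := by
  refine ContDiffOn.mul ?_ (contDiffOn_sqrtDet g x₀)
  rw [← contMDiffOn_iff_contDiffOn]
  exact hρ.comp_contMDiffOn (contMDiffOn_chart_symm.of_le (m := 1) (n := ∞) (by simp))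

theorem contDiffOn_coordField {V : (x : M) → TangentSpace 𝓘(ℝ, Euc n) x} (hV : IsC1Field V)
    (x₀ : M) : ContDiffOn ℝ 1 (coordField V x₀) (chartAt (Euc n) x₀).target := by
  have : IsManifold 𝓘(ℝ, Euc n) 1 M := IsManifold.of_le (n := ∞) (by simp)
  have hopen := (chartAt (Euc n) x₀).open_source
  have hchart : ContMDiffOn 𝓘(ℝ, Euc n) 𝓘(ℝ, Euc n) ∞ (chartAt (Euc n) x₀)
    (chartAt (Euc n) x₀).source := contMDiffOn_chart
  have hsymm : ContMDiffOn 𝓘(ℝ, Euc n) 𝓘(ℝ, Euc n) 1 (chartAt (Euc n) x₀).symm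
    (chartAt (Euc n) x₀).target := contMDiffOn_chart_symm.of_le (m := 1) (n := ∞) (by simp)
  have h1 := hchart.contMDiffOn_tangentMapWithin (m := 1) (by norm_cast) hopen.uniqueMDiffOn
  have h2 := h1.comp (hV.comp_contMDiffOn hsymm) (fun y hy => (chartAt (Euc n) x₀).map_target hy)
  have h3 := (contMDiff_snd_tangentBundle_modelSpace (n := 1) (Euc n) 𝓘(ℝ, Euc n)).comp_contMDiffOn h2
  rw [← contMDiffOn_iff_contDiffOn]
  refine h3.congr fun y hy => ?_
  simp only [Function.comp, tangentMapWithin, coordField]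
  rw [mfderivWithin_of_isOpen hopen ((chartAt (Euc n) x₀).map_target hy)]

theorem continuous_along {V : (x : M) → TangentSpace 𝓘(ℝ, Euc n) x} (hV : IsC1Field V) {f : M → ℝ}
    (hf : ContMDiff 𝓘(ℝ, Euc n) 𝓘(ℝ, ℝ) ∞ f) : Continuous (along V f) := by
  have : IsManifold 𝓘(ℝ, Euc n) 1 M := IsManifold.of_le (n := ∞) (by simp)
  have h1 := hf.contMDiff_tangentMap (m := 1) (by norm_cast)
  exact ((contMDiff_snd_tangentBundle_modelSpace (n := 1) ℝ 𝓘(ℝ, ℝ)).comp (h1.comp hV)).continuous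

/-- Chain rule, together with the fact that the derivative of the inverse chart sends the
coordinates of V back to V. -/
theorem along_eq_fderiv (V : (x : M) → TangentSpace 𝓘(ℝ, Euc n) x) {f : M → ℝ}
    (hf : ContMDiff 𝓘(ℝ, Euc n) 𝓘(ℝ, ℝ) ∞ f) (x₀ : M) {y : Euc n}
    (hy : y ∈ (chartAt (Euc n) x₀).target) :
    along V f ((chartAt (Euc n) x₀).symm y) =
      fderiv ℝ (f ∘ (chartAt (Euc n) x₀).symm) y (coordField V x₀ y) := by
  have : IsManifold 𝓘(ℝ, Euc n) 1 M := IsManifold.of_le (n := ∞) (by simp)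
  have hc := mdifferentiable_chart (I := 𝓘(ℝ, Euc n)) x₀
  have hd := hc.mdifferentiableAt_symm hy
  have h1 : mfderiv 𝓘(ℝ, Euc n) 𝓘(ℝ, ℝ) (f ∘ (chartAt (Euc n) x₀).symm) y = _ :=
    mfderiv_comp y (hf.mdifferentiable (by simp) _) hd
  rw [← mfderiv_eq_fderiv, h1]
  have h2 := hc.symm_comp_deriv ((chartAt (Euc n) x₀).map_target hy)
  rw [(chartAt (Euc n) x₀).right_inv hy] at h2
  have h3 : mfderiv 𝓘(ℝ, Euc n) 𝓘(ℝ, Euc n) (chartAt (Euc n) x₀).symm y (coordField V x₀ y) =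
    V ((chartAt (Euc n) x₀).symm y) := DFunLike.congr_fun h2 _
  exact (congrArg (mfderiv 𝓘(ℝ, Euc n) 𝓘(ℝ, ℝ) f ((chartAt (Euc n) x₀).symm y)) h3).symm

end Chart

/-! ### The weighted volume as a pushforward of a density on a chart -/

section ChartMeasure

variable {n : ℕ} {M : Type*} [TopologicalSpace M] [ChartedSpace (Euc n) M]
  [IsManifold 𝓘(ℝ, Euc n) ∞ M] [MeasurableSpace M] [BorelSpace M]

theorem aemeasurable_chart_symm (x₀ : M) :
    AEMeasurable (chartAt (Euc n) x₀).symm (volume.restrict (chartAt (Euc n) x₀).target) :=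
  (chartAt (Euc n) x₀).continuousOn_symm.aemeasurable (chartAt (Euc n) x₀).open_target.measurableSet

/-- Turns the setwise definition of the volume into an equality of measures, from which integrals
can be transported. -/
theorem volume_restrict_source {g : Metric n M} {vol : Measure M}
    (hvol : IsRiemannianVolume g vol) (x₀ : M) :
    vol.restrict (chartAt (Euc n) x₀).source =
      ((volume.restrict (chartAt (Euc n) x₀).target).withDensity
        (fun y => ENNReal.ofReal (sqrtDet g x₀ y))).map (chartAt (Euc n) x₀).symm := by
  have hs := (chartAt (Euc n) x₀).open_source.measurableSet
  ext A hA
  rw [Measure.restrict_apply hA, hvol x₀ _ (hA.inter hs) inter_subset_right,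
    Measure.map_apply_of_aemeasurable
      ((aemeasurable_chart_symm x₀).mono_ac (withDensity_absolutelyContinuous _ _)) hA,
    withDensity_apply', Measure.restrict_restrict'
      (chartAt (Euc n) x₀).open_target.measurableSet]
  congr 2
  ext y
  simp only [mem_inter_iff, mem_preimage]
  exact ⟨fun h => ⟨h.2.1, h.1⟩, fun h => ⟨h.2, h.1, (chartAt (Euc n) x₀).map_target h.2⟩⟩

theorem aemeasurable_sqrtDet (g : Metric n M) (x₀ : M) :
    AEMeasurable (fun y => ENNReal.ofReal (sqrtDet g x₀ y))
      (volume.restrict (chartAt (Euc n) x₀).target) :=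
  ((contDiffOn_sqrtDet g x₀).continuousOn.aemeasurable
    (chartAt (Euc n) x₀).open_target.measurableSet).ennreal_ofReal

theorem aemeasurable_localDensity (g : Metric n M) {ρ : M → ℝ}
    (hρ : ContMDiff 𝓘(ℝ, Euc n) 𝓘(ℝ, ℝ) 1 ρ) (x₀ : M) :
    AEMeasurable (fun y => ENNReal.ofReal (localDensity g ρ x₀ y))
      (volume.restrict (chartAt (Euc n) x₀).target) :=
  ((contDiffOn_localDensity g hρ x₀).continuousOn.aemeasurable
    (chartAt (Euc n) x₀).open_target.measurableSet).ennreal_ofReal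

theorem restrict_source_eq_map {g : Metric n M} {vol : Measure M}
    (hvol : IsRiemannianVolume g vol) {ρ : M → ℝ} (hρ : ContMDiff 𝓘(ℝ, Euc n) 𝓘(ℝ, ℝ) 1 ρ)
    (hρpos : ∀ x, 0 < ρ x) (x₀ : M) :
    (vol.withDensity (fun x => ENNReal.ofReal (ρ x))).restrict (chartAt (Euc n) x₀).source =
      ((volume.restrict (chartAt (Euc n) x₀).target).withDensity
        (fun y => ENNReal.ofReal (localDensity g ρ x₀ y))).map (chartAt (Euc n) x₀).symm := by
  have hs := (chartAt (Euc n) x₀).open_source.measurableSet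
  have hρm : Measurable fun x => ENNReal.ofReal (ρ x) := hρ.continuous.measurable.ennreal_ofReal
  have hmap := aemeasurable_chart_symm (n := n) x₀
  rw [restrict_withDensity hs, volume_restrict_source hvol]
  ext A hA
  rw [withDensity_apply _ hA, ← lintegral_indicator hA,
    lintegral_map' (hρm.indicator hA).aemeasurable
      (hmap.mono_ac (withDensity_absolutelyContinuous _ _)),
    ← Function.comp_def (f := indicator A _),
    lintegral_withDensity_eq_lintegral_mul₀ (aemeasurable_sqrtDet g x₀)
      ((hρm.indicator hA).comp_aemeasurable hmap),
    Measure.map_apply_of_aemeasurable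
      (hmap.mono_ac (withDensity_absolutelyContinuous _ _)) hA, withDensity_apply',
    ← lintegral_indicator₀ (hmap.nullMeasurableSet_preimage hA)]
  refine lintegral_congr fun y => ?_
  by_cases hy : (chartAt (Euc n) x₀).symm y ∈ A
  · rw [indicator_of_mem (by exact hy)]
    simp only [Pi.mul_apply, Function.comp_apply, indicator_of_mem hy, localDensity]
    rw [ENNReal.ofReal_mul (hρpos _).le, mul_comm]
  · rw [indicator_of_notMem (by exact hy)]
    simp [hy]

theorem localDensity_pos (g : Metric n M) {ρ : M → ℝ} (hρpos : ∀ x, 0 < ρ x) (x₀ : M) {y : Euc n}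
    (hy : y ∈ (chartAt (Euc n) x₀).target) : 0 < localDensity g ρ x₀ y :=
  mul_pos (hρpos _) (sqrtDet_pos g x₀ hy)

theorem integral_eq_chart {g : Metric n M} {vol : Measure M}
    (hvol : IsRiemannianVolume g vol) {ρ : M → ℝ} (hρ : ContMDiff 𝓘(ℝ, Euc n) 𝓘(ℝ, ℝ) 1 ρ)
    (hρpos : ∀ x, 0 < ρ x) (x₀ : M) {F : M → ℝ} (hF : Continuous F)
    (hsupp : Function.support F ⊆ (chartAt (Euc n) x₀).source) :
    ∫ x, F x ∂(vol.withDensity (fun x => ENNReal.ofReal (ρ x))) =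
      ∫ y in (chartAt (Euc n) x₀).target,
        localDensity g ρ x₀ y * F ((chartAt (Euc n) x₀).symm y) := by
  have hmap := aemeasurable_chart_symm (n := n) x₀
  rw [← setIntegral_eq_integral_of_forall_compl_eq_zero (s := (chartAt (Euc n) x₀).source)
      (fun x hx => by_contra fun h => hx (hsupp h)),
    restrict_source_eq_map hvol hρ hρpos,
    integral_map (hmap.mono_ac (withDensity_absolutelyContinuous _ _))
      hF.measurable.aestronglyMeasurable,
    integral_withDensity_eq_integral_toReal_smul₀ (aemeasurable_localDensity g hρ x₀)
      (ae_of_all _ fun _ => ENNReal.ofReal_lt_top)]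
  refine setIntegral_congr_fun (chartAt (Euc n) x₀).open_target.measurableSet fun y hy => ?_
  simp only [smul_eq_mul, ENNReal.toReal_ofReal (localDensity_pos g hρpos x₀ hy).le]

/-- The chart density is continuous, hence integrable over a compact neighbourhood inside the chart.
-/
theorem isLocallyFiniteMeasure {g : Metric n M} {vol : Measure M}
    (hvol : IsRiemannianVolume g vol) {ρ : M → ℝ} (hρ : ContMDiff 𝓘(ℝ, Euc n) 𝓘(ℝ, ℝ) 1 ρ)
    (hρpos : ∀ x, 0 < ρ x) :
    IsLocallyFiniteMeasure (vol.withDensity (fun x => ENNReal.ofReal (ρ x))) := by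
  refine ⟨fun x => ?_⟩
  have hmap := aemeasurable_chart_symm (n := n) x
  set ψ := chartAt (Euc n) x with hψ
  obtain ⟨K, hKmem, hKsub, hK⟩ := local_compact_nhds
    (ψ.open_target.mem_nhds (mem_chart_target (Euc n) x))
  have hU : IsOpen (ψ.source ∩ ψ ⁻¹' interior K) :=
    ψ.continuousOn.isOpen_inter_preimage ψ.open_source isOpen_interior
  refine ⟨_, hU.mem_nhds ⟨mem_chart_source _ x, mem_interior_iff_mem_nhds.2 hKmem⟩, ?_⟩
  have h1 := congrArg (fun μ => μ (ψ.source ∩ ψ ⁻¹' interior K))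
    (restrict_source_eq_map hvol hρ hρpos x)
  rw [Measure.restrict_apply hU.measurableSet, inter_eq_left.2 inter_subset_left,
    Measure.map_apply_of_aemeasurable
      (hmap.mono_ac (withDensity_absolutelyContinuous _ _)) hU.measurableSet,
    withDensity_apply' _ (ψ.symm ⁻¹' _),
    Measure.restrict_restrict' ψ.open_target.measurableSet] at h1
  rw [h1]
  have hint : IntegrableOn (localDensity g ρ x) K :=
    ((contDiffOn_localDensity g hρ x).continuousOn.mono hKsub).integrableOn_compact hK
  refine lt_of_le_of_lt (lintegral_mono_set fun y hy => ?_) hint.lintegral_lt_top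
  have := hy.1.2
  rw [mem_preimage, ψ.right_inv hy.2] at this
  exact interior_subset this

end ChartMeasure

/-! ### Integration by parts in one chart -/

section Divergence

variable {n : ℕ} {M : Type*} [TopologicalSpace M] [ChartedSpace (Euc n) M]

/-- The expression in the chart at `x₀` of a function on `M`, extended by zero. -/
noncomputable def chartExt (x₀ : M) (h : M → ℝ) : Euc n → ℝ :=
  indicator (chartAt (Euc n) x₀).target (h ∘ (chartAt (Euc n) x₀).symm)

variable [T2Space M]

theorem tsupport_chartExt {h : M → ℝ} (hh : HasCompactSupport h) {x₀ : M}
    (hsupp : tsupport h ⊆ (chartAt (Euc n) x₀).source) :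
    tsupport (chartExt (n := n) x₀ h) ⊆ chartAt (Euc n) x₀ '' tsupport h ∧
      IsCompact (chartAt (Euc n) x₀ '' tsupport h) ∧
      chartAt (Euc n) x₀ '' tsupport h ⊆ (chartAt (Euc n) x₀).target := by
  have hK : IsCompact (chartAt (Euc n) x₀ '' tsupport h) :=
    IsCompact.image_of_continuousOn hh ((chartAt (Euc n) x₀).continuousOn.mono hsupp)
  refine ⟨closure_minimal (fun y hy => ?_) hK.isClosed, hK, ?_⟩
  · have hy1 : y ∈ (chartAt (Euc n) x₀).target := by
      by_contra hn
      exact hy (indicator_of_notMem hn _)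
    have hy2 : h ((chartAt (Euc n) x₀).symm y) ≠ 0 := by
      rw [Function.mem_support, chartExt, indicator_of_mem hy1] at hy
      exact hy
    exact ⟨_, subset_tsupport _ hy2, (chartAt (Euc n) x₀).right_inv hy1⟩
  · rintro _ ⟨x, hx, rfl⟩
    exact (chartAt (Euc n) x₀).map_source (hsupp hx)

variable [IsManifold 𝓘(ℝ, Euc n) ∞ M]

/-- A point outside the chart target has a neighbourhood missing the compact image of the support,
so extension by zero creates no singularity. -/
theorem contDiff_chartExt {h : M → ℝ} (hh : IsTest n h) {x₀ : M}
    (hsupp : tsupport h ⊆ (chartAt (Euc n) x₀).source) :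
    ContDiff ℝ ∞ (chartExt (n := n) x₀ h) := by
  obtain ⟨h1, h2, h3⟩ := tsupport_chartExt hh.2 hsupp
  rw [contDiff_iff_contDiffAt]
  intro y
  by_cases hy : y ∈ (chartAt (Euc n) x₀).target
  · have hn := (chartAt (Euc n) x₀).open_target.mem_nhds hy
    have h4 : ContMDiffOn 𝓘(ℝ, Euc n) 𝓘(ℝ, ℝ) ∞ (h ∘ (chartAt (Euc n) x₀).symm)
        (chartAt (Euc n) x₀).target := hh.1.comp_contMDiffOn contMDiffOn_chart_symm
    refine ((contMDiffOn_iff_contDiffOn.1 h4).contDiffAt hn).congr_of_eventuallyEq ?_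
    filter_upwards [hn] with z hz
    exact indicator_of_mem hz _
  · have hn : (tsupport (chartExt (n := n) x₀ h))ᶜ ∈ 𝓝 y :=
      (isClosed_tsupport _).isOpen_compl.mem_nhds fun hy' => hy (h3 (h1 hy'))
    refine (contDiffAt_const (c := (0 : ℝ))).congr_of_eventuallyEq ?_
    filter_upwards [hn] with z hz
    exact image_eq_zero_of_notMem_tsupport hz

theorem eq_sum_stdVec (v : Euc n) : v = ∑ i, v i • stdVec i := by
  ext k
  simp [stdVec, Pi.single_apply]

theorem integrable_mul_of_tsupport_subset {U : Set (Euc n)} (hU : IsOpen U) {F H : Euc n → ℝ}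
    (hF : ContinuousOn F U) (hH : Continuous H) (hc : HasCompactSupport H) (hs : tsupport H ⊆ U) :
    Integrable (fun y => F y * H y) := by
  have hs' : tsupport (fun y => F y * H y) ⊆ U :=
    (closure_mono (Function.support_mul_subset_right F H)).trans hs
  exact ((hF.mul hH.continuousOn).continuous_of_tsupport_subset hU hs').integrable_of_hasCompactSupport
    hc.mul_left

variable [MeasurableSpace M] [BorelSpace M]

theorem support_along_subset (V : (x : M) → TangentSpace 𝓘(ℝ, Euc n) x) (f : M → ℝ) :
    Function.support (along V f) ⊆ tsupport f := by
  intro x hx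
  by_contra hn
  apply hx
  have : f =ᶠ[𝓝 x] fun _ => (0 : ℝ) := notMem_tsupport_iff_eventuallyEq.1 hn
  rw [along, this.mfderiv_eq, mfderiv_const]
  rfl

/-- With D the density and W the coordinates of V, integrating D ∑ Wⁱ ∂ᵢH by parts gives −∑ ∂ᵢ(D Wⁱ)
H = −D (div_m V) H, which is at most −c D H because H ≥ 0. -/
theorem integral_along_le_of_chart {g : Metric n M} {vol : Measure M}
    (hvol : IsRiemannianVolume g vol) {ρ : M → ℝ} (hρ : ContMDiff 𝓘(ℝ, Euc n) 𝓘(ℝ, ℝ) 1 ρ)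
    (hρpos : ∀ x, 0 < ρ x) {V : (x : M) → TangentSpace 𝓘(ℝ, Euc n) x} (hV : IsC1Field V) {c : ℝ}
    (hdiv : DivergenceGe g ρ V c) {h : M → ℝ} (hh : IsTest n h) (h0 : ∀ x, 0 ≤ h x) {x₀ : M}
    (hsupp : tsupport h ⊆ (chartAt (Euc n) x₀).source) :
    ∫ x, along V h x ∂(vol.withDensity (fun x => ENNReal.ofReal (ρ x))) ≤
      -c * ∫ x, h x ∂(vol.withDensity (fun x => ENNReal.ofReal (ρ x))) := by
  rw [integral_eq_chart hvol hρ hρpos x₀ (continuous_along hV hh.1)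
      ((support_along_subset V h).trans hsupp),
    integral_eq_chart hvol hρ hρpos x₀ hh.continuous ((subset_tsupport h).trans hsupp)]
  set ψ := chartAt (Euc n) x₀ with hψ
  set H : Euc n → ℝ := chartExt x₀ h with hHdef
  obtain ⟨s1, s2, s3⟩ := tsupport_chartExt hh.2 hsupp
  have hHs : ContDiff ℝ ∞ H := contDiff_chartExt hh hsupp
  have hHc : HasCompactSupport H := HasCompactSupport.of_support_subset_isCompact s2
    ((subset_tsupport _).trans s1)
  have hHt : tsupport H ⊆ ψ.target := s1.trans s3
  have hHeq : ∀ y ∈ ψ.target, h (ψ.symm y) = H y := fun y hy =>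
    (indicator_of_mem hy (h ∘ ψ.symm)).symm
  set D := localDensity g ρ x₀ with hD
  have hDs : ContDiffOn ℝ 1 D ψ.target := contDiffOn_localDensity g hρ x₀
  set W := coordField V x₀ with hW
  have hWs : ContDiffOn ℝ 1 W ψ.target := contDiffOn_coordField hV x₀
  have hFs : ∀ i, ContDiffOn ℝ 1 (fun z => D z * W z i) ψ.target := fun i =>
    hDs.mul ((EuclideanSpace.proj i : Euc n →L[ℝ] ℝ).contDiff.comp_contDiffOn hWs)
  have hdH : ∀ i, Continuous fun y => fderiv ℝ H y (stdVec i) := fun i =>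
    (hHs.continuous_fderiv (by simp)).clm_apply continuous_const
  have hdHt : ∀ i, tsupport (fun y => fderiv ℝ H y (stdVec i)) ⊆ tsupport H := fun i =>
    tsupport_fderiv_apply_subset ℝ _
  have hdHc : ∀ i, HasCompactSupport fun y => fderiv ℝ H y (stdVec i) := fun i =>
    hHc.fderiv_apply ℝ _
  have hdF : ∀ i, ContinuousOn (fun y => fderiv ℝ (fun z => D z * W z i) y (stdVec i)) ψ.target :=
    fun i => ((hFs i).continuousOn_fderiv_of_isOpen ψ.open_target le_rfl).clm_apply
      continuousOn_const
  have hi1 : ∀ i, Integrable fun y => D y * W y i * fderiv ℝ H y (stdVec i) := fun i =>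
    integrable_mul_of_tsupport_subset ψ.open_target (hFs i).continuousOn (hdH i) (hdHc i)
      ((hdHt i).trans hHt)
  have hi2 : ∀ i, Integrable fun y => fderiv ℝ (fun z => D z * W z i) y (stdVec i) * H y :=
    fun i => integrable_mul_of_tsupport_subset ψ.open_target (hdF i) hHs.continuous hHc hHt
  -- The coefficient D Wⁱ is controlled only on the chart target; differentiability on the support
  -- of H suffices.
  have hparts : ∀ i, ∫ y, D y * W y i * fderiv ℝ H y (stdVec i) =
      -∫ y, fderiv ℝ (fun z => D z * W z i) y (stdVec i) * H y := fun i =>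
    integral_mul_fderiv_eq_neg_fderiv_mul_of_integrable (hi2 i) (hi1 i)
      (integrable_mul_of_tsupport_subset ψ.open_target (hFs i).continuousOn hHs.continuous hHc hHt)
      (fun y hy => ((hFs i).differentiableOn one_ne_zero).differentiableAt
        (ψ.open_target.mem_nhds (hHt hy)))
      (fun y _ => hHs.differentiable (by simp) y)
  have hleft : ∫ y in ψ.target, D y * along V h (ψ.symm y) =
      -∫ y, ∑ i, fderiv ℝ (fun z => D z * W z i) y (stdVec i) * H y := by
    rw [integral_finsetSum _ fun i _ => hi2 i, ← Finset.sum_neg_distrib]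
    simp_rw [← hparts]
    rw [← integral_finsetSum _ fun i _ => hi1 i]
    refine Eq.trans ?_ (setIntegral_eq_integral_of_forall_compl_eq_zero (s := ψ.target) ?_)
    · refine setIntegral_congr_fun ψ.open_target.measurableSet fun y hy => ?_
      have hev : h ∘ ψ.symm =ᶠ[𝓝 y] H := by
        filter_upwards [ψ.open_target.mem_nhds hy] with z hz
        exact hHeq z hz
      simp only
      rw [along_eq_fderiv V hh.1 x₀ hy, hev.fderiv_eq]
      conv_lhs => rw [eq_sum_stdVec (coordField V x₀ y)]
      rw [map_sum, Finset.mul_sum]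
      refine Finset.sum_congr rfl fun i _ => ?_
      rw [map_smul, smul_eq_mul, mul_assoc]
    · intro y hy
      refine Finset.sum_eq_zero fun i _ => ?_
      rw [image_eq_zero_of_notMem_tsupport (f := fun y => fderiv ℝ H y (stdVec i))
        fun h' => hy (hHt (hdHt i h')), mul_zero]
  have hright : ∫ y in ψ.target, D y * h (ψ.symm y) = ∫ y, D y * H y := by
    refine Eq.trans ?_ (setIntegral_eq_integral_of_forall_compl_eq_zero (s := ψ.target) ?_)
    · refine setIntegral_congr_fun ψ.open_target.measurableSet fun y hy => ?_
      simp only [hHeq y hy]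
    · intro y hy
      rw [show H y = 0 from indicator_of_notMem hy (h ∘ ψ.symm), mul_zero]
  rw [hleft, hright, neg_mul, neg_le_neg_iff, ← integral_const_mul]
  refine integral_mono ((integrable_mul_of_tsupport_subset ψ.open_target hDs.continuousOn
    hHs.continuous hHc hHt).const_mul c) (integrable_finsetSum _ fun i _ => hi2 i) fun y => ?_
  by_cases hy : y ∈ ψ.target
  · have hd := hdiv x₀ (ψ.symm y) (ψ.map_target hy)
    rw [divergence, ψ.right_inv hy] at hd
    have hDpos : 0 < D y := localDensity_pos g hρpos x₀ hy
    have hH0 : 0 ≤ H y := by rw [← hHeq y hy]; exact h0 _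
    rw [inv_mul_eq_div, le_div_iff₀ hDpos] at hd
    simp only
    rw [← Finset.sum_mul, ← mul_assoc]
    exact mul_le_mul_of_nonneg_right hd hH0
  · have : H y = 0 := indicator_of_notMem hy (h ∘ ψ.symm)
    simp [this]

end Divergence

/-! ### Test functions, locality of S, and the global divergence inequality -/

section Test

variable {n : ℕ} {M : Type*} [TopologicalSpace M] [ChartedSpace (Euc n) M]

theorem isTest_zero : IsTest n (0 : M → ℝ) := ⟨contMDiff_const, HasCompactSupport.zero⟩

theorem IsTest.add {f g : M → ℝ} (hf : IsTest n f) (hg : IsTest n g) : IsTest n (f + g) :=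
  ⟨hf.1.add hg.1, hf.2.add hg.2⟩

theorem contMDiff_const_smul {f : M → ℝ} (hf : ContMDiff 𝓘(ℝ, Euc n) 𝓘(ℝ, ℝ) ∞ f) (c : ℝ) :
    ContMDiff 𝓘(ℝ, Euc n) 𝓘(ℝ, ℝ) ∞ (c • f) := by
  have h : ContMDiff 𝓘(ℝ, Euc n) 𝓘(ℝ, ℝ) ∞ fun x => c * f x := contMDiff_const.mul hf
  exact h

theorem IsTest.smul {f : M → ℝ} (hf : IsTest n f) (c : ℝ) : IsTest n (c • f) :=
  ⟨contMDiff_const_smul hf.1 c, hf.2.smul_left (f := fun _ => c)⟩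

theorem IsTest.mul_left {f g : M → ℝ} (hg : ContMDiff 𝓘(ℝ, Euc n) 𝓘(ℝ, ℝ) ∞ g)
    (hf : IsTest n f) : IsTest n (fun x => g x * f x) :=
  ⟨hg.mul hf.1, hf.2.mul_left⟩

variable (n M) in
/-- The vector space `C_c^∞(M)`. -/
def testSpace : Submodule ℝ (M → ℝ) where
  carrier := {f | IsTest n f}
  add_mem' := fun hf hg => hf.add hg
  zero_mem' := isTest_zero
  smul_mem' := fun c _ hf => hf.smul c

theorem testSpace_isTest (f : testSpace n M) : IsTest n (f : M → ℝ) := f.2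

/-- The derivative along `V` as a linear map on `C_c^∞(M)`. -/
noncomputable def alongLin (V : (x : M) → TangentSpace 𝓘(ℝ, Euc n) x) :
    testSpace n M →ₗ[ℝ] (M → ℝ) where
  toFun f := along V f
  map_add' f g := by
    funext x
    have := ((testSpace_isTest f).mdifferentiableAt x).hasMFDerivAt.add
      ((testSpace_isTest g).mdifferentiableAt x).hasMFDerivAt
    exact congrArg (fun L => L (V x)) this.mfderiv
  map_smul' c f := by
    funext x
    have := ((testSpace_isTest f).mdifferentiableAt x).hasMFDerivAt.const_smul c
    exact congrArg (fun L => L (V x)) this.mfderiv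

theorem alongLin_apply (V : (x : M) → TangentSpace 𝓘(ℝ, Euc n) x) (f : testSpace n M) :
    alongLin V f = along V f := rfl

variable [IsManifold 𝓘(ℝ, Euc n) ∞ M]

theorem IsTest.comp_chart_symm {f : M → ℝ} (hf : ContMDiff 𝓘(ℝ, Euc n) 𝓘(ℝ, ℝ) ∞ f) (x₀ : M) :
    ContDiffOn ℝ ∞ (f ∘ (chartAt (Euc n) x₀).symm) (chartAt (Euc n) x₀).target :=
  contMDiffOn_iff_contDiffOn.1 (hf.comp_contMDiffOn contMDiffOn_chart_symm)

theorem fderiv_fderiv_smul_add {E : Type*} [NormedAddCommGroup E] [NormedSpace ℝ E] {U : Set E}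
    (hU : IsOpen U) {f g : E → ℝ} (hf : ContDiffOn ℝ ∞ f U) (hg : ContDiffOn ℝ ∞ g U) (c : ℝ)
    (v : E) {y : E} (hy : y ∈ U) :
    fderiv ℝ (c • f + g) y = c • fderiv ℝ f y + fderiv ℝ g y ∧
    fderiv ℝ (fun z => fderiv ℝ (c • f + g) z v) y =
      c • fderiv ℝ (fun z => fderiv ℝ f z v) y + fderiv ℝ (fun z => fderiv ℝ g z v) y := by
  have hd : ∀ {h : E → ℝ}, ContDiffOn ℝ ∞ h U → ∀ z ∈ U, DifferentiableAt ℝ h z :=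
    fun hh z hz => (hh.differentiableOn (by simp)).differentiableAt (hU.mem_nhds hz)
  have hd2 : ∀ {h : E → ℝ}, ContDiffOn ℝ ∞ h U → DifferentiableAt ℝ (fun z => fderiv ℝ h z v) y :=
    fun hh => (((hh.fderiv_of_isOpen (m := 1) hU (by norm_cast)).differentiableOn
      one_ne_zero).differentiableAt (hU.mem_nhds hy)).clm_apply (differentiableAt_const v)
  have h1 : ∀ z ∈ U, fderiv ℝ (c • f + g) z = c • fderiv ℝ f z + fderiv ℝ g z := fun z hz => by
    rw [fderiv_add ((hd hf z hz).const_smul c) (hd hg z hz), fderiv_const_smul (hd hf z hz)]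
  refine ⟨h1 y hy, ?_⟩
  have hev : (fun z => fderiv ℝ (c • f + g) z v) =ᶠ[𝓝 y]
      (c • fun z => fderiv ℝ f z v) + fun z => fderiv ℝ g z v := by
    filter_upwards [hU.mem_nhds hy] with z hz
    rw [h1 z hz]
    rfl
  rw [hev.fderiv_eq, fderiv_add ((hd2 hf).const_smul c) (hd2 hg), fderiv_const_smul (hd2 hf)]

/-- Linearity is not assumed of S; it is read off the coordinate expression and holds on smooth
functions. -/
theorem IsSecondOrderOperator.smul_add {S : (M → ℝ) → M → ℝ} (hS : IsSecondOrderOperator n S)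
    {f g : M → ℝ} (hf : ContMDiff 𝓘(ℝ, Euc n) 𝓘(ℝ, ℝ) ∞ f)
    (hg : ContMDiff 𝓘(ℝ, Euc n) 𝓘(ℝ, ℝ) ∞ g) (c : ℝ) : S (c • f + g) = c • S f + S g := by
  funext x
  obtain ⟨a, b, d, h⟩ := hS x
  have hx := mem_chart_source (Euc n) x
  have hU := (chartAt (Euc n) x).open_target
  have hy := mem_chart_target (Euc n) x
  have hcomp : (c • f + g) ∘ (chartAt (Euc n) x).symm =
    c • (f ∘ (chartAt (Euc n) x).symm) + g ∘ (chartAt (Euc n) x).symm := rfl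
  have key := fun v => fderiv_fderiv_smul_add hU (IsTest.comp_chart_symm hf x)
    (IsTest.comp_chart_symm hg x) c v hy
  rw [h _ ((contMDiff_const_smul hf c).add hg) x hx, Pi.add_apply (c • S f), Pi.smul_apply c (S f),
    h f hf x hx,
    h g hg x hx, hcomp]
  simp only [(key _).2, (key 0).1, add_apply, smul_apply, smul_eq_mul, mul_add,
    Finset.sum_add_distrib, Finset.mul_sum, Pi.add_apply, Pi.smul_apply, mul_left_comm _ c]
  ring

/-- The coordinate expression at x involves only the germ of the function at x. -/
theorem IsSecondOrderOperator.congr_of_eventuallyEq {S : (M → ℝ) → M → ℝ}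
    (hS : IsSecondOrderOperator n S) {f g : M → ℝ} (hf : ContMDiff 𝓘(ℝ, Euc n) 𝓘(ℝ, ℝ) ∞ f)
    (hg : ContMDiff 𝓘(ℝ, Euc n) 𝓘(ℝ, ℝ) ∞ g) {x : M} (hfg : f =ᶠ[𝓝 x] g) : S f x = S g x := by
  obtain ⟨a, b, d, h⟩ := hS x
  have hx := mem_chart_source (Euc n) x
  have hev : f ∘ (chartAt (Euc n) x).symm =ᶠ[𝓝 (chartAt (Euc n) x x)]
      g ∘ (chartAt (Euc n) x).symm := by
    have hc := (chartAt (Euc n) x).continuousAt_symm (mem_chart_target (Euc n) x)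
    rw [ContinuousAt, (chartAt (Euc n) x).left_inv hx] at hc
    exact hc.eventually hfg
  have hev2 : ∀ v, (fun z => fderiv ℝ (f ∘ (chartAt (Euc n) x).symm) z v)
      =ᶠ[𝓝 (chartAt (Euc n) x x)] fun z => fderiv ℝ (g ∘ (chartAt (Euc n) x).symm) z v := fun v => by
    filter_upwards [hev.fderiv (𝕜 := ℝ)] with z hz
    rw [hz]
  rw [h f hf x hx, h g hg x hx, hfg.eq_of_nhds, hev.fderiv_eq]
  simp only [(hev2 _).fderiv_eq]

theorem IsSecondOrderOperator.map_zero {S : (M → ℝ) → M → ℝ} (hS : IsSecondOrderOperator n S) :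
    S 0 = 0 := by
  have := hS.smul_add (f := 0) (g := 0) contMDiff_const contMDiff_const 1
  simpa using this

/-- A second order operator as a linear map on `C_c^∞(M)`. -/
noncomputable def opLin {S : (M → ℝ) → M → ℝ} (hS : IsSecondOrderOperator n S) :
    testSpace n M →ₗ[ℝ] (M → ℝ) where
  toFun f := S f
  map_add' f g := by
    have := hS.smul_add (testSpace_isTest f).1 (testSpace_isTest g).1 1
    simpa using this
  map_smul' c f := by
    have := hS.smul_add (testSpace_isTest f).1 isTest_zero.1 c
    simpa [hS.map_zero] using this

theorem IsSecondOrderOperator.support_subset {S : (M → ℝ) → M → ℝ}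
    (hS : IsSecondOrderOperator n S) {f : M → ℝ} (hf : ContMDiff 𝓘(ℝ, Euc n) 𝓘(ℝ, ℝ) ∞ f) :
    Function.support (S f) ⊆ tsupport f := by
  intro x hx
  by_contra hn
  apply hx
  rw [hS.congr_of_eventuallyEq hf (g := 0) contMDiff_const
    (notMem_tsupport_iff_eventuallyEq.1 hn), hS.map_zero]
  rfl

variable [T2Space M] [SecondCountableTopology M]

theorem sigmaCompactSpace_of_charted (n : ℕ) (M : Type*) [TopologicalSpace M]
    [ChartedSpace (Euc n) M] [SecondCountableTopology M] : SigmaCompactSpace M :=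
  have := ChartedSpace.locallyCompactSpace (Euc n) M
  inferInstance

/-- Being 1 near every point of K, and not just on K, allows S χ = S 1 = 0 there by locality. -/
theorem exists_cutoff {K : Set M} (hK : IsCompact K) :
    ∃ χ : M → ℝ, IsTest n χ ∧ ∀ x ∈ K, χ =ᶠ[𝓝 x] fun _ => 1 := by
  have := ChartedSpace.locallyCompactSpace (Euc n) M
  have := sigmaCompactSpace_of_charted n M
  obtain ⟨K', hK', hKK'⟩ := exists_compact_superset hK
  obtain ⟨χ, h1, h2, -⟩ := exists_contMDiffMap_one_nhds_of_subset_interior (n := (⊤ : ℕ∞))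
    𝓘(ℝ, Euc n) hK.isClosed hKK'
  refine ⟨χ, ⟨χ.contMDiff, HasCompactSupport.of_support_subset_isCompact hK' fun x hx => ?_⟩,
    fun x hx => Filter.Eventually.filter_mono (nhds_le_nhdsSet hx) h1⟩
  by_contra hn
  exact hx (h2 x hn)

variable [MeasurableSpace M] [BorelSpace M]

/-- The divergence inequality: `∫ V h dm ≤ -c ∫ h dm` for nonnegative `h` if `div_m V ≥ c`. -/
theorem integral_along_le {g : Metric n M} {vol : Measure M}
    (hvol : IsRiemannianVolume g vol) {ρ : M → ℝ} (hρ : ContMDiff 𝓘(ℝ, Euc n) 𝓘(ℝ, ℝ) 1 ρ)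
    (hρpos : ∀ x, 0 < ρ x) {V : (x : M) → TangentSpace 𝓘(ℝ, Euc n) x} (hV : IsC1Field V) {c : ℝ}
    (hdiv : DivergenceGe g ρ V c) {h : M → ℝ} (hh : IsTest n h) (h0 : ∀ x, 0 ≤ h x) :
    ∫ x, along V h x ∂(vol.withDensity (fun x => ENNReal.ofReal (ρ x))) ≤
      -c * ∫ x, h x ∂(vol.withDensity (fun x => ENNReal.ofReal (ρ x))) := by
  have := sigmaCompactSpace_of_charted n M
  have := isLocallyFiniteMeasure hvol hρ hρpos
  set m := vol.withDensity (fun x => ENNReal.ofReal (ρ x)) with hm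
  obtain ⟨χ, hχ⟩ := SmoothPartitionOfUnity.exists_isSubordinate_chartAt_source 𝓘(ℝ, Euc n) M
  -- By local finiteness only finitely many members of the partition meet the compact support of h.
  have hfin : {i | (Function.support (χ i) ∩ tsupport h).Nonempty}.Finite :=
    χ.locallyFinite.finite_nonempty_inter_compact hh.2
  set s := hfin.toFinset with hs
  have ht : ∀ i, IsTest n (fun x => χ i x * h x) := fun i => IsTest.mul_left (χ i).contMDiff hh
  have hsum : h = ∑ i ∈ s, fun x => χ i x * h x := by
    funext x
    rw [Finset.sum_apply, ← Finset.sum_mul]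
    by_cases hx : h x = 0
    · simp [hx]
    · rw [χ.sum_finsupport' x (mem_univ x), one_mul]
      intro i hi
      rw [SmoothPartitionOfUnity.mem_finsupport] at hi
      rw [hs, Set.Finite.mem_toFinset]
      exact ⟨x, hi, subset_tsupport _ hx⟩
  -- The constant c is the same in all charts, so the local inequalities can be summed.
  have hle : ∀ i, ∫ x, along V (fun x => χ i x * h x) x ∂m ≤ -c * ∫ x, χ i x * h x ∂m := fun i =>
    integral_along_le_of_chart hvol hρ hρpos hV hdiv (ht i)
      (fun x => mul_nonneg (χ.nonneg i x) (h0 x)) (x₀ := i)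
      ((closure_mono (Function.support_mul_subset_left _ _)).trans (hχ i))
  have hal : along V h = ∑ i ∈ s, along V (fun x => χ i x * h x) := by
    have := map_sum (alongLin V) (fun i => (⟨_, ht i⟩ : testSpace n M)) s
    simp only [alongLin_apply, Submodule.coe_sum] at this
    rwa [← hsum] at this
  have hi1 : ∀ i, Integrable (along V (fun x => χ i x * h x)) m := fun i =>
    (continuous_along hV (ht i).1).integrable_of_hasCompactSupport
      ((ht i).2.mono' (support_along_subset V _))
  have hi2 : ∀ i, Integrable (fun x => χ i x * h x) m := fun i =>
    (ht i).continuous.integrable_of_hasCompactSupport (ht i).2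
  calc ∫ x, along V h x ∂m = ∑ i ∈ s, ∫ x, along V (fun x => χ i x * h x) x ∂m := by
        rw [hal, ← integral_finsetSum _ fun i _ => hi1 i]
        simp only [Finset.sum_apply]
    _ ≤ ∑ i ∈ s, -c * ∫ x, χ i x * h x ∂m := Finset.sum_le_sum fun i _ => hle i
    _ = -c * ∫ x, h x ∂m := by
        rw [← Finset.mul_sum, ← integral_finsetSum _ fun i _ => hi2 i]
        conv_rhs => rw [hsum]
        simp only [Finset.sum_apply]

end Test

/-! ### The energy as an operator pairing, its coercivity and its sector bound -/

section Energy

variable {n : ℕ} {M : Type*} [TopologicalSpace M] [ChartedSpace (Euc n) M]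
  [MeasurableSpace M] {m : Measure M}

/-- A linear map from `C_c^∞(M)` to functions, with values in `L²(m)`. -/
noncomputable def mkL2 (L : testSpace n M →ₗ[ℝ] (M → ℝ)) (hL : ∀ f, MemLp (L f) 2 m) :
    testSpace n M →ₗ[ℝ] Lp ℝ 2 m where
  toFun f := (hL f).toLp (L f)
  map_add' f g := by
    rw [← MemLp.toLp_add]
    exact MemLp.toLp_congr _ _ (by rw [map_add])
  map_smul' c f := by
    rw [RingHom.id_apply, ← MemLp.toLp_const_smul]
    exact MemLp.toLp_congr _ _ (by rw [map_smul])

theorem inner_toLp {u v : M → ℝ} (hu : MemLp u 2 m) (hv : MemLp v 2 m) :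
    inner ℝ (hu.toLp u) (hv.toLp v) = ∫ x, u x * v x ∂m := by
  rw [L2.inner_def]
  refine integral_congr_ae ?_
  filter_upwards [hu.coeFn_toLp, hv.coeFn_toLp] with x h1 h2
  simp [h1, h2, mul_comm]

variable [IsManifold 𝓘(ℝ, Euc n) ∞ M] [T2Space M] [SecondCountableTopology M]
  [BorelSpace M] [IsFiniteMeasureOnCompacts m]

theorem IsTest.memLp {f : M → ℝ} (hf : IsTest n f) : MemLp f 2 m :=
  hf.continuous.memLp_of_hasCompactSupport hf.2

theorem hasCompactSupport_along (V : (x : M) → TangentSpace 𝓘(ℝ, Euc n) x) {f : M → ℝ}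
    (hf : IsTest n f) : HasCompactSupport (along V f) :=
  hf.2.mono' (support_along_subset V f)

theorem memLp_along {V : (x : M) → TangentSpace 𝓘(ℝ, Euc n) x} (hV : IsC1Field V) {f : M → ℝ}
    (hf : IsTest n f) : MemLp (along V f) 2 m :=
  (continuous_along hV hf.1).memLp_of_hasCompactSupport (hasCompactSupport_along V hf)

variable (m) in
/-- The embedding of `C_c^∞(M)` in `L²(m)`. -/
noncomputable def testL2 : testSpace n M →ₗ[ℝ] Lp ℝ 2 m :=
  mkL2 (testSpace n M).subtype fun f => (testSpace_isTest f).memLp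

variable (m) in
/-- The derivative along a `C¹` field, from `C_c^∞(M)` to `L²(m)`. -/
noncomputable def alongL2 {V : (x : M) → TangentSpace 𝓘(ℝ, Euc n) x} (hV : IsC1Field V) :
    testSpace n M →ₗ[ℝ] Lp ℝ 2 m :=
  mkL2 (alongLin V) fun f => memLp_along hV (testSpace_isTest f)

/-- A symmetric diffusion operator, from `C_c^∞(M)` to `L²(m)`. -/
noncomputable def opL2 {S : (M → ℝ) → M → ℝ} (hS : IsSymmetricDiffusionOperator n m S) :
    testSpace n M →ₗ[ℝ] Lp ℝ 2 m :=
  mkL2 (opLin hS.secondOrder) fun f => hS.memLp f (testSpace_isTest f)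

/-- The bilinear form `⟨T f, g⟩` on `C_c^∞(M)`. -/
noncomputable def pairing (T : testSpace n M →ₗ[ℝ] Lp ℝ 2 m) :
    testSpace n M →ₗ[ℝ] testSpace n M →ₗ[ℝ] ℝ :=
  (innerₗ (Lp ℝ 2 m)).compl₁₂ T (testL2 m)

theorem pairing_apply (T : testSpace n M →ₗ[ℝ] Lp ℝ 2 m) (f g : testSpace n M) :
    pairing T f g = inner ℝ (T f) (testL2 m g) := rfl

theorem pairing_mkL2 (L : testSpace n M →ₗ[ℝ] (M → ℝ)) (hL : ∀ f, MemLp (L f) 2 m)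
    (f g : testSpace n M) : pairing (mkL2 L hL) f g = ∫ x, L f x * (g : M → ℝ) x ∂m :=
  inner_toLp (hL f) (testSpace_isTest g).memLp

theorem pairing_testL2 (f g : testSpace n M) :
    pairing (testL2 m) f g = ∫ x, (f : M → ℝ) x * (g : M → ℝ) x ∂m := pairing_mkL2 _ _ f g

theorem pairing_testL2_self (f : testSpace n M) : pairing (testL2 m) f f = ‖testL2 m f‖ ^ 2 :=
  real_inner_self_eq_norm_sq (testL2 m f)

theorem pairing_alongL2 {V : (x : M) → TangentSpace 𝓘(ℝ, Euc n) x} (hV : IsC1Field V)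
    (f g : testSpace n M) : pairing (alongL2 m hV) f g = ∫ x, along V f x * (g : M → ℝ) x ∂m :=
  pairing_mkL2 _ _ f g

theorem pairing_opL2 {S : (M → ℝ) → M → ℝ} (hS : IsSymmetricDiffusionOperator n m S)
    (f g : testSpace n M) : pairing (opL2 hS) f g = ∫ x, S f x * (g : M → ℝ) x ∂m :=
  pairing_mkL2 _ _ f g

theorem fieldForm_eq {V : (x : M) → TangentSpace 𝓘(ℝ, Euc n) x} (hV : IsC1Field V)
    (f g : testSpace n M) : fieldForm m V f g = pairing (-alongL2 m hV) f g := by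
  rw [pairing_apply, LinearMap.neg_apply, inner_neg_left, ← pairing_apply, pairing_alongL2]
  rfl

/-- With a cutoff χ equal to 1 near the support of h, symmetry gives ∫ Sh = ∫ (Sh) χ = ∫ h (Sχ), and
Sχ = S1 = 0 on that support. -/
theorem IsSymmetricDiffusionOperator.integral_eq_zero {S : (M → ℝ) → M → ℝ}
    (hS : IsSymmetricDiffusionOperator n m S) {h : M → ℝ} (hh : IsTest n h) :
    Integrable (S h) m ∧ ∫ x, S h x ∂m = 0 := by
  obtain ⟨χ, hχ, hχ1⟩ := exists_cutoff (n := n) hh.2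
  have h1 : S h = fun x => S h x * χ x := by
    funext x
    by_cases hx : x ∈ tsupport h
    · rw [(hχ1 x hx).eq_of_nhds, mul_one]
    · rw [Function.notMem_support.1 fun h' => hx (hS.secondOrder.support_subset hh.1 h'), zero_mul]
  refine ⟨?_, ?_⟩
  · rw [h1]
    exact (hS.memLp h hh).integrable_mul hχ.memLp
  · rw [h1, hS.symmetric h χ hh hχ]
    refine integral_eq_zero_of_ae (ae_of_all _ fun x => ?_)
    simp only [Pi.zero_apply]
    by_cases hx : x ∈ tsupport h
    · rw [hS.secondOrder.congr_of_eventuallyEq hχ.1 contMDiff_const (hχ1 x hx), hS.map_one]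
      exact mul_zero _
    · rw [image_eq_zero_of_notMem_tsupport hx, zero_mul]

/-- The operator which represents the form `ℰ_α`. -/
noncomputable def energyOp {S : (M → ℝ) → M → ℝ} (hS : IsSymmetricDiffusionOperator n m S)
    {V₀ : (x : M) → TangentSpace 𝓘(ℝ, Euc n) x} (hV₀ : IsC1Field V₀) (α : ℝ) :
    testSpace n M →ₗ[ℝ] Lp ℝ 2 m :=
  -opL2 hS + -alongL2 m hV₀ + α • testL2 m

theorem pairing_energyOp {S : (M → ℝ) → M → ℝ} (hS : IsSymmetricDiffusionOperator n m S)
    {V₀ : (x : M) → TangentSpace 𝓘(ℝ, Euc n) x} (hV₀ : IsC1Field V₀) (α : ℝ)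
    (f g : testSpace n M) : pairing (energyOp hS hV₀ α) f g =
      pairing (-opL2 hS) f g + pairing (-alongL2 m hV₀) f g + α * pairing (testL2 m) f g := by
  simp only [pairing_apply, energyOp, LinearMap.add_apply, LinearMap.smul_apply, inner_add_left,
    real_inner_smul_left]

theorem pairing_neg (T : testSpace n M →ₗ[ℝ] Lp ℝ 2 m) (f g : testSpace n M) :
    pairing (-T) f g = -pairing T f g := by
  simp only [pairing_apply, LinearMap.neg_apply, inner_neg_left]

/-- Since ∫ S(fg) dm = 0, symmetry reduces ∫ Γ(f,g) dm to −⟨Sf,g⟩. The resulting representation by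
an L²-valued operator is what closability requires. -/
theorem energy_eq {S : (M → ℝ) → M → ℝ} (hS : IsSymmetricDiffusionOperator n m S)
    {V₀ : (x : M) → TangentSpace 𝓘(ℝ, Euc n) x} (hV₀ : IsC1Field V₀) (α : ℝ)
    (f g : testSpace n M) : energy m S V₀ α f g = pairing (energyOp hS hV₀ α) f g := by
  have hf := testSpace_isTest f
  have hg := testSpace_isTest g
  have hfg : IsTest n fun y => (f : M → ℝ) y * (g : M → ℝ) y := IsTest.mul_left hf.1 hg
  obtain ⟨i1, i2⟩ := hS.integral_eq_zero hfg
  have i3 : Integrable (fun x => (f : M → ℝ) x * S g x) m := hf.memLp.integrable_mul (hS.memLp _ hg)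
  have i4 : Integrable (fun x => (g : M → ℝ) x * S f x) m := hg.memLp.integrable_mul (hS.memLp _ hf)
  have hΓ : ∫ x, carreDuChamp S f g x ∂m = pairing (-opL2 hS) f g := by
    rw [pairing_neg, pairing_opL2]
    unfold carreDuChamp
    rw [integral_div, integral_sub (by exact i1.sub i3) i4, integral_sub i1 i3, i2,
      ← hS.symmetric _ _ hf hg]
    simp only [mul_comm ((g : M → ℝ) _)]
    ring
  rw [energy, hΓ, fieldForm_eq hV₀, ← pairing_testL2, ← pairing_energyOp]

theorem along_mul_self (V : (x : M) → TangentSpace 𝓘(ℝ, Euc n) x) {f : M → ℝ} (hf : IsTest n f)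
    (x : M) : along V (fun y => f y * f y) x = 2 * (along V f x * f x) := by
  have h := (hf.mdifferentiableAt x).hasMFDerivAt.mul (hf.mdifferentiableAt x).hasMFDerivAt
  have h2 := congrArg (fun L => L (V x)) h.mfderiv
  have h3 : along V (fun y => f y * f y) x = f x * along V f x + f x * along V f x := h2
  rw [h3]
  ring

variable {g : Metric n M} {vol : Measure M} {ρ : M → ℝ} {S : (M → ℝ) → M → ℝ}
  {V₀ : (x : M) → TangentSpace 𝓘(ℝ, Euc n) x} {c₁ α : ℝ}

/-- The form `ℰ_{α₀ + 1}` dominates the `L²` norm. -/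
theorem norm_sq_le_energy (hvol : IsRiemannianVolume g vol)
    (hρ : ContMDiff 𝓘(ℝ, Euc n) 𝓘(ℝ, ℝ) 1 ρ) (hρpos : ∀ x, 0 < ρ x)
    (hm : m = vol.withDensity (fun x => ENNReal.ofReal (ρ x)))
    (hS : IsSymmetricDiffusionOperator n m S) (hV₀ : IsC1Field V₀)
    (hdiv : DivergenceGe g ρ V₀ c₁) (hα : α = -c₁ / 2 + 1) (f : testSpace n M) :
    ‖testL2 m f‖ ^ 2 ≤ pairing (energyOp hS hV₀ α) f f := by
  have hf := testSpace_isTest f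
  -- Applied to f², this reads 2⟨V₀f,f⟩ ≤ −c₁‖f‖². The shift −c₁/2 in α cancels this contribution
  -- and the remaining 1 gives the L² norm.
  have h1 := integral_along_le hvol hρ hρpos hV₀ hdiv
    (h := fun y => (f : M → ℝ) y * (f : M → ℝ) y) (IsTest.mul_left hf.1 hf)
    (fun x => mul_self_nonneg _)
  rw [← hm, ← pairing_testL2] at h1
  simp only [along_mul_self V₀ hf] at h1
  rw [integral_const_mul, ← pairing_alongL2 hV₀] at h1
  have h2 := hS.nonpos f hf
  rw [← pairing_opL2 hS] at h2
  rw [pairing_energyOp, pairing_neg, pairing_neg, ← pairing_testL2_self, hα]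
  linarith

theorem SectorCondition.qBounded (hS : IsSymmetricDiffusionOperator n m S) (hV₀ : IsC1Field V₀)
    {V : (x : M) → TangentSpace 𝓘(ℝ, Euc n) x} (hV : IsC1Field V)
    (hsector : SectorCondition m S V₀ α V) :
    QBounded (pairing (energyOp hS hV₀ α)) (pairing (-alongL2 m hV)) := by
  obtain ⟨K, hK⟩ := hsector
  refine ⟨K, fun f g => ?_⟩
  rw [pairing_neg, abs_neg, pairing_alongL2, ← energy_eq, ← energy_eq]
  exact hK f g (testSpace_isTest f) (testSpace_isTest g)

/-- The form is not symmetric, so Cauchy-Schwarz does not apply to it directly. It applies to the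
symmetric part −⟨Sf,g⟩; the V₀ term is bounded by the sector condition and the α term by the L²
domination. -/
theorem qBounded_energy (hS : IsSymmetricDiffusionOperator n m S) (hV₀ : IsC1Field V₀)
    (hle : ∀ f : testSpace n M, ‖testL2 m f‖ ^ 2 ≤ pairing (energyOp hS hV₀ α) f f)
    (hsector : QBounded (pairing (energyOp hS hV₀ α)) (pairing (-alongL2 m hV₀))) :
    QBounded (pairing (energyOp hS hV₀ α)) (pairing (energyOp hS hV₀ α)) := by
  obtain ⟨K, hK0, hK⟩ := hsector.exists_pos
  set A := pairing (energyOp hS hV₀ α) with hA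
  have hA0 : ∀ f, 0 ≤ A f f := fun f => (sq_nonneg _).trans (hle f)
  set G := pairing (-opL2 hS) with hG
  have hG0 : ∀ f, 0 ≤ G f f := fun f => by
    rw [hG, pairing_neg, pairing_opL2]
    have := hS.nonpos f (testSpace_isTest f)
    linarith
  have hGs : ∀ f g, G f g = G g f := fun f g => by
    rw [hG, pairing_neg, pairing_neg, pairing_opL2, pairing_opL2,
      hS.symmetric f g (testSpace_isTest f) (testSpace_isTest g)]
    simp only [mul_comm]
  -- Solve the decomposition of the energy for the symmetric part and bound the two other terms by K
  -- and |α| times the energy.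
  have hC : ∀ f, G f f ≤ (1 + K + |α|) * A f f := fun f => by
    have h1 := pairing_energyOp hS hV₀ α f f
    have h2 := hK f f
    rw [mul_assoc, Real.mul_self_sqrt (hA0 f)] at h2
    have h3 : |α * pairing (testL2 m) f f| ≤ |α| * A f f := by
      rw [abs_mul, pairing_testL2_self, abs_of_nonneg (sq_nonneg ‖testL2 m f‖)]
      exact mul_le_mul_of_nonneg_left (hle f) (abs_nonneg _)
    have h4 := neg_abs_le (α * pairing (testL2 m) f f)
    have h5 := neg_abs_le (pairing (-alongL2 m hV₀) f f)
    rw [← hA, ← hG] at h1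
    linarith
  refine ⟨(1 + K + |α|) + K + |α|, fun f g => ?_⟩
  have e1 : |G f g| ≤ (1 + K + |α|) * Real.sqrt (A f f) * Real.sqrt (A g g) := by
    refine (abs_le_sqrt_mul_sqrt hG0 hGs f g).trans ?_
    have hc : 0 ≤ 1 + K + |α| := by positivity
    calc Real.sqrt (G f f) * Real.sqrt (G g g)
        ≤ Real.sqrt ((1 + K + |α|) * A f f) * Real.sqrt ((1 + K + |α|) * A g g) :=
          mul_le_mul (Real.sqrt_le_sqrt (hC f)) (Real.sqrt_le_sqrt (hC g)) (Real.sqrt_nonneg _)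
            (Real.sqrt_nonneg _)
      _ = _ := by
          rw [Real.sqrt_mul hc, Real.sqrt_mul hc]
          linear_combination Real.sqrt (A f f) * Real.sqrt (A g g) * Real.mul_self_sqrt hc
  have e2 : |α * pairing (testL2 m) f g| ≤ |α| * Real.sqrt (A f f) * Real.sqrt (A g g) := by
    rw [abs_mul, mul_assoc]
    refine mul_le_mul_of_nonneg_left ((abs_real_inner_le_norm (testL2 m f) (testL2 m g)).trans ?_) (abs_nonneg _)
    exact mul_le_mul (Real.le_sqrt_of_sq_le (hle f)) (Real.le_sqrt_of_sq_le (hle g)) (norm_nonneg _)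
      (Real.sqrt_nonneg _)
  rw [hA, pairing_energyOp]
  refine (abs_add_three _ _ _).trans ?_
  rw [add_mul, add_mul, add_mul, add_mul]
  exact add_le_add (add_le_add e1 (hK f g)) e2

end Energy

/-! ### Differentiation along the flow and antisymmetry of V -/

section FlowDeriv

variable {n : ℕ} {M : Type*} [TopologicalSpace M] [ChartedSpace (Euc n) M]
  [MeasurableSpace M] {m : Measure M}

theorem hasDerivAt_comp_flow {V : (x : M) → TangentSpace 𝓘(ℝ, Euc n) x} {φ : Flow ℝ M}
    (hφ : ∀ x : M, IsMIntegralCurve (I := 𝓘(ℝ, Euc n)) (fun t => φ t x) V) {f : M → ℝ}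
    (hf : IsTest n f) (x : M) (s : ℝ) :
    HasDerivAt (fun t => f (φ t x)) (along V f (φ s x)) s := by
  have h := (hf.mdifferentiableAt (φ s x)).hasMFDerivAt.comp s (hφ x s)
  let L : ℝ →L[ℝ] ℝ := (mfderiv 𝓘(ℝ, Euc n) 𝓘(ℝ, ℝ) f (φ s x)).comp
    ((1 : ℝ →L[ℝ] ℝ).smulRight (V (φ s x)))
  have h2 : HasFDerivAt (fun t => f (φ t x)) L s := hasMFDerivAt_iff_hasFDerivAt.1 h
  have h3 : L 1 = mfderiv 𝓘(ℝ, Euc n) 𝓘(ℝ, ℝ) f (φ s x) ((1 : ℝ) • V (φ s x)) := rfl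
  have h4 := h2.hasDerivAt
  rwa [h3, one_smul] at h4

variable [IsManifold 𝓘(ℝ, Euc n) ∞ M] [T2Space M] [SecondCountableTopology M] [BorelSpace M]

theorem flow_continuous (φ : Flow ℝ M) (t : ℝ) : Continuous (φ t) :=
  φ.continuous continuous_const continuous_id

theorem hasDerivAt_integral_comp_flow {V : (x : M) → TangentSpace 𝓘(ℝ, Euc n) x} (hV : IsC1Field V)
    {φ : Flow ℝ M} (hφ : ∀ x : M, IsMIntegralCurve (I := 𝓘(ℝ, Euc n)) (fun t => φ t x) V)
    {u : M → ℝ} (hu : LocallyIntegrable u m) {f : M → ℝ} (hf : IsTest n f) (s : ℝ) :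
    HasDerivAt (fun t => ∫ x, u x * f (φ t x) ∂m) (∫ x, u x * along V f (φ s x) ∂m) s := by
  -- The points that the flow brings into the support of f at some time within 1 of s form a subset
  -- of this compact set, outside which the integrands vanish; u is integrable on it.
  set K : Set M := (fun q : ℝ × M => φ (-q.1) q.2) '' (Icc (s - 1) (s + 1) ×ˢ tsupport f) with hK
  have hKc : IsCompact K := (isCompact_Icc.prod hf.2).image
    (φ.continuous continuous_fst.neg continuous_snd)
  have hKm : MeasurableSet K := hKc.measurableSet
  have hKmem : ∀ t ∈ Metric.ball s 1, ∀ x, φ t x ∈ tsupport f → x ∈ K := by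
    intro t ht x hx
    rw [Real.ball_eq_Ioo] at ht
    refine ⟨(t, φ t x), ⟨Ioo_subset_Icc_self ht, hx⟩, ?_⟩
    simp only
    rw [← Flow.map_add, neg_add_cancel, Flow.map_zero_apply]
  have hcont := continuous_along hV hf.1
  obtain ⟨C, hC⟩ := hcont.bounded_above_of_compact_support
    (hf.2.mono' (support_along_subset V f))
  have huK : IntegrableOn u K m := hu.integrableOn_isCompact hKc
  have hum : AEStronglyMeasurable u m := hu.aestronglyMeasurable
  have hmeas : ∀ t, AEStronglyMeasurable (fun x => u x * f (φ t x)) m := fun t =>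
    hum.mul (hf.continuous.comp (flow_continuous φ t)).measurable.aestronglyMeasurable
  refine (hasDerivAt_integral_of_dominated_loc_of_deriv_le
    (F := fun t x => u x * f (φ t x)) (F' := fun t x => u x * along V f (φ t x))
    (bound := K.indicator fun x => ‖u x‖ * C) (Metric.ball_mem_nhds s one_pos)
    (Eventually.of_forall hmeas) ?_ ?_ ?_ ?_ ?_).2
  · obtain ⟨C', hC'⟩ := hf.continuous.bounded_above_of_compact_support hf.2
    refine Integrable.mono' (g := K.indicator fun x => ‖u x‖ * C')
      ((integrable_indicator_iff hKm).2 (huK.norm.mul_const C')) (hmeas s) (ae_of_all _ fun x => ?_)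
    by_cases hx : x ∈ K
    · rw [indicator_of_mem hx, norm_mul]
      exact mul_le_mul_of_nonneg_left (hC' _) (norm_nonneg _)
    · rw [indicator_of_notMem hx, image_eq_zero_of_notMem_tsupport
        fun h => hx (hKmem s (Metric.mem_ball_self one_pos) x h)]
      simp
  · exact hum.mul (hcont.comp (flow_continuous φ s)).measurable.aestronglyMeasurable
  · refine ae_of_all _ fun x t ht => ?_
    by_cases hx : x ∈ K
    · rw [indicator_of_mem hx, norm_mul]
      exact mul_le_mul_of_nonneg_left (hC _) (norm_nonneg _)
    · rw [indicator_of_notMem hx, Function.notMem_support.1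
        fun h => hx (hKmem t ht x (support_along_subset V f h))]
      simp
  · exact (integrable_indicator_iff hKm).2 (huK.norm.mul_const C)
  · exact ae_of_all _ fun x t _ => (hasDerivAt_comp_flow hφ hf x t).const_mul (u x)

theorem integral_comp_flow {φ : Flow ℝ M} (hinv : IsInvariantMeasure φ m) (F : M → ℝ) (t : ℝ) :
    ∫ x, F (φ t x) ∂m = ∫ x, F x ∂m :=
  (hinv t).integral_comp (φ.toHomeomorph t).measurableEmbedding F

/-- A field which preserves `m` is antisymmetric. -/
theorem integral_along_mul_comp_flow [IsFiniteMeasureOnCompacts m]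
    {V : (x : M) → TangentSpace 𝓘(ℝ, Euc n) x} (hV : IsC1Field V)
    {φ : Flow ℝ M} (hφ : ∀ x : M, IsMIntegralCurve (I := 𝓘(ℝ, Euc n)) (fun t => φ t x) V)
    (hinv : IsInvariantMeasure φ m) {f h : M → ℝ} (hf : IsTest n f) (hh : IsTest n h) (t : ℝ) :
    ∫ x, along V f x * h (φ t x) ∂m = -∫ x, f x * along V h (φ t x) ∂m := by
  have := ChartedSpace.locallyCompactSpace (Euc n) M
  have h1 := hasDerivAt_integral_comp_flow (m := m) hV hφ
    (u := fun x => h (φ t x)) (hh.continuous.comp (flow_continuous φ t)).locallyIntegrable hf 0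
  have h2 := hasDerivAt_integral_comp_flow (m := m) hV hφ hf.continuous.locallyIntegrable hh (t - 0)
  have h3 := h2.scomp (0 : ℝ) ((hasDerivAt_id (0 : ℝ)).const_sub t)
  -- By invariance of m, ∫ (h∘φ_t)(f∘φ_s) = ∫ f (h∘φ_{t−s}). Differentiating both sides at s = 0
  -- gives the claim; h∘φ_t enters only as a continuous weight.
  have h4 : (fun s => ∫ x, h (φ t x) * f (φ s x) ∂m) =
      (fun r => ∫ x, f x * h (φ r x) ∂m) ∘ fun s => t - id s := by
    funext s
    simp only [Function.comp, id]
    rw [← integral_comp_flow hinv (fun x => f x * h (φ (t - s) x)) s]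
    refine integral_congr_ae (ae_of_all _ fun x => ?_)
    simp only
    rw [← Flow.map_add, sub_add_cancel, mul_comm]
  rw [h4] at h1
  have h5 := h1.unique h3
  simp only [Flow.map_zero_apply, sub_zero, neg_smul, one_smul] at h5
  rw [← h5]
  simp only [mul_comm]

end FlowDeriv

/-! ### Almost invariant functions and the ergodic decomposition -/

section Invariant

variable {M : Type*} [TopologicalSpace M] [MeasurableSpace M] [BorelSpace M]
  [SecondCountableTopology M] {φ : Flow ℝ M} {m : Measure M}

theorem measurable_flow (φ : Flow ℝ M) : Measurable fun q : ℝ × M => φ q.1 q.2 :=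
  (φ.continuous continuous_fst continuous_snd).measurable

theorem invariantSigma_le : invariantSigma φ m ≤ ‹MeasurableSpace M› :=
  MeasurableSpace.generateFrom_le fun _ h => h.elim (fun h => h.1) (fun h => h.1)

/-- An almost invariant Borel set coincides almost everywhere with an invariant one. -/
theorem exists_invariantSet_ae_eq [SFinite m] {A : Set M} (hA : MeasurableSet A)
    (hinv : ∀ t, ∀ᵐ x ∂m, φ t x ∈ A ↔ x ∈ A) :
    ∃ B, IsInvariantSet φ B ∧ ∀ᵐ x ∂m, x ∈ B ↔ x ∈ A := by
  -- The set of points whose orbit lies in A for almost every time is strictly invariant, as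
  -- Lebesgue measure is translation invariant.
  refine ⟨{x | ∀ᵐ s : ℝ, φ s x ∈ A}, ⟨?_, fun t => ?_⟩, ?_⟩
  · have h : MeasurableSet {q : M × ℝ | φ q.2 q.1 ∈ Aᶜ} :=
      ((measurable_flow φ).comp measurable_swap) hA.compl
    exact (measurable_measure_prodMk_left (ν := (volume : Measure ℝ)) h)
      (measurableSet_singleton 0)
  · have key : ∀ (r : ℝ) (x : M), (∀ᵐ s : ℝ, φ s x ∈ A) → ∀ᵐ s : ℝ, φ s (φ r x) ∈ A := by
      intro r x hx
      have := (measurePreserving_add_right (volume : Measure ℝ) r).quasiMeasurePreserving.ae hx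
      filter_upwards [this] with s hs
      rwa [← Flow.map_add]
    ext x
    refine ⟨fun hx => ?_, key t x⟩
    have h := key (-t) _ hx
    rw [← Flow.map_add, neg_add_cancel, Flow.map_zero_apply] at h
    exact h
  · have h : MeasurableSet {q : ℝ × M | φ q.1 q.2 ∈ A ↔ q.2 ∈ A} :=
      ((measurable_flow φ) hA).iff (measurable_snd hA)
    -- Fubini: for almost every x, membership of φ_s x in A agrees with that of x for almost every
    -- s.
    have h2 := (Measure.ae_ae_comm (μ := (volume : Measure ℝ)) (ν := m)
      (p := fun t x => φ t x ∈ A ↔ x ∈ A) h).1 (ae_of_all _ hinv)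
    filter_upwards [h2] with x hx
    refine ⟨fun h => ?_, fun h => ?_⟩
    · obtain ⟨s, h3, h4⟩ := (hx.and h).exists
      exact h3.1 h4
    · filter_upwards [hx] with s hs using hs.2 h

/-- A differs from a strictly invariant set by two null Borel sets, all of which are generators of
𝓘. -/
theorem measurableSet_invariantSigma [SFinite m] {A : Set M} (hA : MeasurableSet A)
    (hinv : ∀ t, ∀ᵐ x ∂m, φ t x ∈ A ↔ x ∈ A) : MeasurableSet[invariantSigma φ m] A := by
  obtain ⟨B, hB, hBA⟩ := exists_invariantSet_ae_eq hA hinv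
  have hnull : ∀ N, MeasurableSet N → (∀ᵐ x ∂m, x ∉ N) → MeasurableSet[invariantSigma φ m] N :=
    fun N hN h0 => MeasurableSpace.measurableSet_generateFrom
      (Or.inr ⟨hN, by simpa [ae_iff] using h0⟩)
  have hB' : MeasurableSet[invariantSigma φ m] B :=
    MeasurableSpace.measurableSet_generateFrom (Or.inl hB)
  have h1 := hnull (B \ A) (hB.1.diff hA) (hBA.mono fun x hx h => h.2 (hx.1 h.1))
  have h2 := hnull (A \ B) (hA.diff hB.1) (hBA.mono fun x hx h => h.2 (hx.2 h.1))
  have h3 : A = (B \ (B \ A)) ∪ (A \ B) := by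
    ext x; simp only [mem_union, Set.mem_sdiff]; tauto
  rw [h3]
  exact (hB'.diff h1).union h2

/-- The integral of P(x)(A) over the complement of A is m(A ∩ Aᶜ) = 0. -/
theorem IsRegularConditionalProbability.ae_eq_zero {P : M → Measure M}
    (hP : IsRegularConditionalProbability φ m P) {A : Set M}
    (hA : MeasurableSet[invariantSigma φ m] A) : ∀ᵐ x ∂m, x ∉ A → P x A = 0 := by
  have hA' := invariantSigma_le _ hA
  obtain ⟨h1, h2⟩ := hP.2 A hA'
  have h3 := h2 Aᶜ hA.compl
  rw [inter_compl_self, measure_empty,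
    lintegral_eq_zero_iff (h1.mono invariantSigma_le le_rfl)] at h3
  exact (ae_restrict_iff' hA'.compl).1 h3

/-- An almost invariant function is almost everywhere constant under the conditional
probabilities. -/
theorem IsRegularConditionalProbability.ae_ae_eq [SFinite m] {P : M → Measure M}
    (hP : IsRegularConditionalProbability φ m P) {u : M → ℝ} (hu : Measurable u)
    (hinv : IsAlmostInvariant φ m u) : ∀ᵐ x ∂m, ∀ᵐ y ∂(P x), u y = u x := by
  -- Rational sublevel sets determine the value of u, and there are countably many, so a single null
  -- set serves for all.
  have hA : ∀ q : ℚ, MeasurableSet[invariantSigma φ m] {x | u x < q} := fun q =>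
    measurableSet_invariantSigma (measurableSet_lt hu measurable_const) fun t => by
      filter_upwards [hinv t] with x hx
      simp only [Function.comp] at hx
      simp only [hx]
  have h1 := ae_all_iff.2 fun q => hP.ae_eq_zero (hA q)
  have h2 := ae_all_iff.2 fun q => hP.ae_eq_zero (hA q).compl
  filter_upwards [h1, h2] with x hx1 hx2
  have h3 : ∀ᵐ y ∂(P x), ∀ q : ℚ, u y < q ↔ u x < q := by
    refine ae_all_iff.2 fun q => ?_
    by_cases hq : u x < q
    · have := hx2 q (fun h => h hq)
      filter_upwards [measure_eq_zero_iff_ae_notMem.1 this] with y hy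
      simp only [mem_compl_iff, mem_ofPred_eq, not_not] at hy
      exact iff_of_true hy hq
    · filter_upwards [measure_eq_zero_iff_ae_notMem.1 (hx1 q hq)] with y hy
      exact iff_of_false hy hq
  filter_upwards [h3] with y hy
  refine le_antisymm (le_of_forall_rat_lt_imp_le ?_) (le_of_forall_rat_lt_imp_le ?_)
  · intro q hq
    by_contra! h
    exact lt_asymm hq ((hy q).2 h)
  · intro q hq
    by_contra! h
    exact lt_asymm hq ((hy q).1 h)

/-- An almost invariant function factors through the space of ergodic components. -/
theorem exists_factor [SFinite m] {M' : Type*} [MeasurableSpace M'] {π : M → M'} {p : M' → Measure M}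
    (hp : Measurable p) (hpE : ∀ y, IsProbabilityMeasure (p y))
    (hP : IsRegularConditionalProbability φ m (p ∘ π)) (hmp : IsInvariantMeasure φ m)
    {u : M → ℝ} (hu : AEStronglyMeasurable u m) (hinv : IsAlmostInvariant φ m u) :
    ∃ w : M' → ℝ, StronglyMeasurable w ∧ u =ᵐ[m] w ∘ π := by
  have hu' := hu.ae_eq_mk
  -- The measurable version stays almost invariant because φ_t preserves null sets.
  have hinv' : IsAlmostInvariant φ m (hu.mk u) := fun t =>
    (((hmp t).quasiMeasurePreserving.ae_eq_comp hu').symm.trans (hinv t)).trans hu'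
  let κ : ProbabilityTheory.Kernel M' M := ⟨p, hp⟩
  have : ProbabilityTheory.IsMarkovKernel κ := ⟨hpE⟩
  refine ⟨fun y => ∫ x, hu.mk u x ∂(κ y), hu.stronglyMeasurable_mk.integral_kernel, ?_⟩
  filter_upwards [hP.ae_ae_eq hu.stronglyMeasurable_mk.measurable hinv', hu'] with x hx hx'
  rw [hx']
  have := hpE (π x)
  have h1 : ∫ y, hu.mk u y ∂(p (π x)) = ∫ _, hu.mk u x ∂(p (π x)) := integral_congr_ae hx
  change _ = ∫ y, hu.mk u y ∂(p (π x))
  rw [h1]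
  simp

end Invariant

/-! ### Extension of forms to ℋ and the annihilator of ℰ^V -/

theorem QBounded.tendsto_of_tendsto_sub {F : Type*} [AddCommGroup F] [Module ℝ F]
    {A B : F →ₗ[ℝ] F →ₗ[ℝ] ℝ} (hA : ∀ f, 0 ≤ A f f) (hB : QBounded A B) {f f' g g' : ℕ → F}
    (hf : QCauchy A f) (hg' : QCauchy A g')
    (hff' : Tendsto (fun k => A (f' k - f k) (f' k - f k)) atTop (𝓝 0))
    (hgg' : Tendsto (fun k => A (g' k - g k) (g' k - g k)) atTop (𝓝 0)) {c : ℝ}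
    (hc : Tendsto (fun k => B (f k) (g k)) atTop (𝓝 c)) :
    Tendsto (fun k => B (f' k) (g' k)) atTop (𝓝 c) := by
  -- B(f', g') = B(f' − f, g') + B(f, g' − g) + B(f, g), and the first two terms vanish in the
  -- limit.
  have h1 := hB.flip.tendsto_zero_right hA hg' hff'
  have h2 := hB.tendsto_zero_right hA hf hgg'
  have h3 := (h1.add h2).add hc
  simp only [LinearMap.flip_apply, map_sub, add_zero, zero_add] at h3
  refine h3.congr fun k => ?_
  ring

section Domain

variable {n : ℕ} {M : Type*} [TopologicalSpace M] [ChartedSpace (Euc n) M]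
  [MeasurableSpace M] {m : Measure M} {S : (M → ℝ) → M → ℝ}
  {V₀ V : (x : M) → TangentSpace 𝓘(ℝ, Euc n) x} {α : ℝ}

theorem formDomain_congr {u v : M → ℝ} (hu : u ∈ formDomain m S V₀ α) (huv : u =ᵐ[m] v) :
    v ∈ formDomain m S V₀ α := by
  obtain ⟨h1, f, hf⟩ := hu
  refine ⟨h1.ae_eq huv, f, hf.test, hf.cauchy, hf.tendsto.congr fun k => eLpNorm_congr_ae ?_⟩
  filter_upwards [huv] with x hx
  simp [hx]

variable [IsManifold 𝓘(ℝ, Euc n) ∞ M] [T2Space M] [SecondCountableTopology M]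
  [BorelSpace M] [IsFiniteMeasureOnCompacts m]

theorem Approximates.exists_lift (hS : IsSymmetricDiffusionOperator n m S) (hV₀ : IsC1Field V₀)
    {f : ℕ → M → ℝ} {u : M → ℝ} (hf : Approximates m S V₀ α f u) (hu : MemLp u 2 m) :
    ∃ F : ℕ → testSpace n M, (∀ k, (F k : M → ℝ) = f k) ∧
      QCauchy (pairing (energyOp hS hV₀ α)) F ∧
      Tendsto (fun k => testL2 m (F k)) atTop (𝓝 (hu.toLp u)) := by
  refine ⟨fun k => ⟨f k, hf.test k⟩, fun k => rfl, fun ε hε => ?_, ?_⟩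
  · obtain ⟨N, hN⟩ := hf.cauchy ε hε
    refine ⟨N, fun k hk l hl => ?_⟩
    rw [← energy_eq]
    exact hN k hk l hl
  · exact (Lp.tendsto_Lp_iff_tendsto_eLpNorm'' (fun k => f k) (fun k => (hf.test k).memLp) u hu).2
      hf.tendsto

/-- Two approximating sequences of one function differ by a Cauchy sequence that is null in L²,
hence null in energy by closability. Limits of forms are thereby independent of the sequences. -/
theorem tendsto_energy_sub (hS : IsSymmetricDiffusionOperator n m S) (hV₀ : IsC1Field V₀)
    (hA : ∀ f : testSpace n M, 0 ≤ pairing (energyOp hS hV₀ α) f f)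
    (hAA : QBounded (pairing (energyOp hS hV₀ α)) (pairing (energyOp hS hV₀ α)))
    {F F' : ℕ → testSpace n M} (hF : QCauchy (pairing (energyOp hS hV₀ α)) F)
    (hF' : QCauchy (pairing (energyOp hS hV₀ α)) F') {u : Lp ℝ 2 m}
    (hu : Tendsto (fun k => testL2 m (F k)) atTop (𝓝 u))
    (hu' : Tendsto (fun k => testL2 m (F' k)) atTop (𝓝 u)) :
    Tendsto (fun k => pairing (energyOp hS hV₀ α) (F' k - F k) (F' k - F k)) atTop (𝓝 0) := by
  refine tendsto_zero_of_closable (testL2 m) (energyOp hS hV₀ α) (fun _ _ => rfl) hA hAA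
    (hF'.sub hA hF) ?_
  simpa using hu'.sub hu

/-- A form which satisfies the weak sector condition extends to the form domain. -/
theorem existsUnique_hasFormValue (hS : IsSymmetricDiffusionOperator n m S) (hV₀ : IsC1Field V₀)
    (hV : IsC1Field V) (hA : ∀ f : testSpace n M, 0 ≤ pairing (energyOp hS hV₀ α) f f)
    (hAA : QBounded (pairing (energyOp hS hV₀ α)) (pairing (energyOp hS hV₀ α)))
    (hB : QBounded (pairing (energyOp hS hV₀ α)) (pairing (-alongL2 m hV)))
    {u v : M → ℝ} (hu : u ∈ formDomain m S V₀ α) (hv : v ∈ formDomain m S V₀ α) :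
    ∃! c : ℝ, HasFormValue m S V₀ α V u v c := by
  obtain ⟨hu, f, hf⟩ := hu
  obtain ⟨hv, g, hg⟩ := hv
  obtain ⟨F, hFf, hF, hFu⟩ := hf.exists_lift hS hV₀ hu
  obtain ⟨G, hGg, hG, hGv⟩ := hg.exists_lift hS hV₀ hv
  obtain ⟨c, hc⟩ := hB.exists_tendsto hA hF hG
  refine ⟨c, fun f' g' hf' hg' => ?_, fun d hd => ?_⟩
  · obtain ⟨F', hFf', hF', hFu'⟩ := hf'.exists_lift hS hV₀ hu
    obtain ⟨G', hGg', hG', hGv'⟩ := hg'.exists_lift hS hV₀ hv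
    simp only [← hFf', ← hGg', fieldForm_eq hV]
    exact hB.tendsto_of_tendsto_sub hA hF hG' (tendsto_energy_sub hS hV₀ hA hAA hF hF' hFu hFu')
      (tendsto_energy_sub hS hV₀ hA hAA hG hG' hGv hGv') hc
  · have h := hd f g hf hg
    simp only [← hFf, ← hGg, fieldForm_eq hV] at h
    exact tendsto_nhds_unique h hc

variable {φ : Flow ℝ M}

theorem memLp_comp_flow (hinv : IsInvariantMeasure φ m) {u : M → ℝ} (hu : MemLp u 2 m) (t : ℝ) :
    MemLp (fun x => u (φ t x)) 2 m := hu.comp_measurePreserving (hinv t)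

theorem tendsto_integral_mul {F : ℕ → testSpace n M} {u w : M → ℝ} (hu : MemLp u 2 m)
    (hw : MemLp w 2 m) (hF : Tendsto (fun k => testL2 m (F k)) atTop (𝓝 (hu.toLp u))) :
    Tendsto (fun k => ∫ x, (F k : M → ℝ) x * w x ∂m) atTop (𝓝 (∫ x, u x * w x ∂m)) := by
  rw [← inner_toLp hu hw]
  refine (hF.inner (tendsto_const_nhds (x := hw.toLp w))).congr fun k => ?_
  exact inner_toLp (testSpace_isTest (F k)).memLp hw

/-- The function t ↦ ∫ u (f∘φ_t) is constant when u and m are invariant; the integral here is its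
derivative at 0. -/
theorem integral_mul_along_eq_zero (hV : IsC1Field V)
    (hφ : ∀ x : M, IsMIntegralCurve (I := 𝓘(ℝ, Euc n)) (fun t => φ t x) V)
    (hinv : IsInvariantMeasure φ m) {u : M → ℝ} (hu : MemLp u 2 m)
    (hui : IsAlmostInvariant φ m u) {f : M → ℝ} (hf : IsTest n f) :
    ∫ x, u x * along V f x ∂m = 0 := by
  have := ChartedSpace.locallyCompactSpace (Euc n) M
  have h1 := hasDerivAt_integral_comp_flow hV hφ (hu.locallyIntegrable one_le_two) hf 0
  have h2 : (fun t => ∫ x, u x * f (φ t x) ∂m) = fun _ => ∫ x, u x * f x ∂m := by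
    funext t
    rw [← integral_comp_flow hinv (fun x => u x * f x) t]
    refine integral_congr_ae ?_
    filter_upwards [hui t] with x hx
    simp only [Function.comp] at hx
    simp only [hx]
  rw [h2] at h1
  simpa only [Flow.map_zero_apply] using h1.unique (hasDerivAt_const (0 : ℝ) _)

/-- An almost invariant function annihilates the form `ℰ^V`. -/
theorem hasFormValue_zero_of_invariant (hS : IsSymmetricDiffusionOperator n m S)
    (hV₀ : IsC1Field V₀) (hV : IsC1Field V)
    (hA : ∀ f : testSpace n M, 0 ≤ pairing (energyOp hS hV₀ α) f f)
    (hB : QBounded (pairing (energyOp hS hV₀ α)) (pairing (-alongL2 m hV)))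
    (hφ : ∀ x : M, IsMIntegralCurve (I := 𝓘(ℝ, Euc n)) (fun t => φ t x) V)
    (hinv : IsInvariantMeasure φ m) {u v : M → ℝ} (hu : MemLp u 2 m)
    (hui : IsAlmostInvariant φ m u) (hv : MemLp v 2 m) : HasFormValue m S V₀ α V u v 0 := by
  intro f g hf hg
  obtain ⟨F, hFf, hF, hFu⟩ := hf.exists_lift hS hV₀ hu
  obtain ⟨G, hGg, hG, -⟩ := hg.exists_lift hS hV₀ hv
  simp only [← hFf, ← hGg, fieldForm_eq hV]
  -- For a fixed test function G_l, antisymmetry moves V onto G_l; L² convergence of F_k then gives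
  -- ∫ u (V G_l) = 0.
  refine hB.tendsto_of_iterated (a := fun _ => 0) hA hF hG (fun l => ?_) tendsto_const_nhds
  have hGl := testSpace_isTest (G l)
  have h := tendsto_integral_mul hu (memLp_along hV hGl) hFu
  rw [integral_mul_along_eq_zero hV hφ hinv hu hui hGl] at h
  refine h.congr fun k => ?_
  have h2 := integral_along_mul_comp_flow (m := m) hV hφ hinv (testSpace_isTest (F k)) hGl 0
  simp only [Flow.map_zero_apply] at h2
  rw [pairing_neg, pairing_alongL2, h2, neg_neg]

/-- The value of the extension of `ℰ^V` at `(u, f ∘ φ_t)`. -/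
theorem tendsto_fieldForm_comp_flow (hS : IsSymmetricDiffusionOperator n m S)
    (hV₀ : IsC1Field V₀) (hV : IsC1Field V)
    (hA : ∀ f : testSpace n M, 0 ≤ pairing (energyOp hS hV₀ α) f f)
    (hB : QBounded (pairing (energyOp hS hV₀ α)) (pairing (-alongL2 m hV)))
    (hφ : ∀ x : M, IsMIntegralCurve (I := 𝓘(ℝ, Euc n)) (fun t => φ t x) V)
    (hinv : IsInvariantMeasure φ m) {u h : M → ℝ} (hu : MemLp u 2 m) (hh : IsTest n h) (t : ℝ)
    {f g : ℕ → M → ℝ} (hf : Approximates m S V₀ α f u)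
    (hg : Approximates m S V₀ α g (h ∘ φ t)) :
    Tendsto (fun k => fieldForm m V (f k) (g k)) atTop (𝓝 (∫ x, u x * along V h (φ t x) ∂m)) := by
  have hv : MemLp (h ∘ φ t) 2 m := memLp_comp_flow hinv hh.memLp t
  obtain ⟨F, hFf, hF, hFu⟩ := hf.exists_lift hS hV₀ hu
  obtain ⟨G, hGg, hG, hGv⟩ := hg.exists_lift hS hV₀ hv
  simp only [← hFf, ← hGg, fieldForm_eq hV]
  -- Here the approximation of h∘φ_t is passed to the limit first, with F_l fixed so that V acts on
  -- a test function; V is then moved onto h, and F_l → u in L².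
  refine hB.flip.tendsto_of_iterated hA hG hF (fun l => ?_)
    (tendsto_integral_mul hu (memLp_comp_flow hinv (memLp_along hV hh) t) hFu)
  have hFl := testSpace_isTest (F l)
  have h1 := (tendsto_integral_mul hv (memLp_along hV hFl) hGv).neg
  simp only [Function.comp, mul_comm (h _)] at h1
  rw [integral_along_mul_comp_flow hV hφ hinv hFl hh t, neg_neg] at h1
  refine h1.congr fun k => ?_
  rw [LinearMap.flip_apply, pairing_neg, pairing_alongL2]
  simp only [mul_comm]

/-- A function which annihilates `ℰ^V` is almost invariant. -/
theorem isAlmostInvariant_of_integral_eq_zero (hV : IsC1Field V)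
    (hφ : ∀ x : M, IsMIntegralCurve (I := 𝓘(ℝ, Euc n)) (fun t => φ t x) V)
    (hinv : IsInvariantMeasure φ m) {u : M → ℝ} (hu : MemLp u 2 m)
    (h0 : ∀ h : M → ℝ, IsTest n h → ∀ t : ℝ, ∫ x, u x * along V h (φ t x) ∂m = 0) :
    IsAlmostInvariant φ m u := by
  have := sigmaCompactSpace_of_charted n M
  have := ChartedSpace.locallyCompactSpace (Euc n) M
  have hul := hu.locallyIntegrable one_le_two
  intro t
  have hut := memLp_comp_flow hinv hu t
  -- It is enough to test u∘φ_t − u against smooth compactly supported functions.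
  have h := ae_eq_zero_of_integral_contMDiff_smul_eq_zero (μ := m) 𝓘(ℝ, Euc n)
    (f := fun x => u (φ t x) - u x)
    ((hut.locallyIntegrable one_le_two).sub hul) fun f hf hfc => ?_
  · filter_upwards [h] with x hx
    exact sub_eq_zero.1 hx
  have hft : IsTest n f := ⟨hf, hfc⟩
  have hder : ∀ s, HasDerivAt (fun r => ∫ x, u x * f (φ r x) ∂m) 0 s := fun s => by
    have := hasDerivAt_integral_comp_flow hV hφ hul hft s
    rwa [h0 f hft s] at this
  -- Comparing times −t and 0 gives ∫ u (f∘φ_{−t}) = ∫ u f, and invariance of m turns the left side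
  -- into ∫ (u∘φ_t) f.
  have hconst := is_const_of_deriv_eq_zero (fun s => (hder s).differentiableAt)
    (fun s => (hder s).deriv) (-t) 0
  simp only [Flow.map_zero_apply] at hconst
  rw [← integral_comp_flow hinv _ t] at hconst
  simp only [← Flow.map_add, neg_add_cancel, Flow.map_zero_apply] at hconst
  simp only [smul_eq_mul, mul_sub]
  rw [integral_sub (by exact hft.memLp.integrable_mul hut) (by exact hft.memLp.integrable_mul hu),
    sub_eq_zero]
  simpa only [mul_comm] using hconst

end Domain

end FlowForm

/-! ### The proposition -/

theorem mainTheorem12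
    {n : ℕ} {M : Type*} [TopologicalSpace M] [ChartedSpace (FlowForm.Euc n) M]
    [IsManifold 𝓘(ℝ, FlowForm.Euc n) ∞ M] [T2Space M] [SecondCountableTopology M]
    [MeasurableSpace M] [BorelSpace M]
    -- the Riemannian metric, its volume, and the measure `m = ρ vol`
    (g : FlowForm.Metric n M) (vol : Measure M) (hvol : FlowForm.IsRiemannianVolume g vol)
    (ρ : M → ℝ) (hρ : ContMDiff 𝓘(ℝ, FlowForm.Euc n) 𝓘(ℝ, ℝ) 1 ρ) (hρpos : ∀ x, 0 < ρ x)
    (m : Measure M) (hm : m = vol.withDensity (fun x => ENNReal.ofReal (ρ x)))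
    -- the operator `S` and the vector field `V₀` which define the form `ℰ` and its domain
    (S : (M → ℝ) → M → ℝ) (hS : FlowForm.IsSymmetricDiffusionOperator n m S)
    (V₀ : (x : M) → TangentSpace 𝓘(ℝ, FlowForm.Euc n) x) (hV₀ : FlowForm.IsC1Field V₀)
    (c₁ : ℝ) (hdiv : FlowForm.DivergenceGe g ρ V₀ c₁)
    (α : ℝ) (hα : α = -c₁ / 2 + 1)
    (hsector₀ : FlowForm.SectorCondition m S V₀ α V₀)
    -- the complete vector field `V` and its flow
    (V : (x : M) → TangentSpace 𝓘(ℝ, FlowForm.Euc n) x) (hV : FlowForm.IsC1Field V)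
    (φ : Flow ℝ M) (hφ : ∀ x : M, IsMIntegralCurve (I := 𝓘(ℝ, FlowForm.Euc n)) (fun t => φ t x) V)
    (hinv : FlowForm.IsInvariantMeasure φ m)
    (hsector : FlowForm.SectorCondition m S V₀ α V)
    (hcomp : ∀ f : M → ℝ, FlowForm.IsTest n f → ∀ t : ℝ,
      f ∘ φ t ∈ FlowForm.formDomain m S V₀ α)
    -- exhaustion by compact invariant sets
    (Mc : ℕ → Set M) (hMc_mono : Monotone Mc) (hMc_compact : ∀ k, IsCompact (Mc k))
    (hMc_inv : ∀ k, FlowForm.IsInvariantSet φ (Mc k)) (hMc_union : ⋃ k, Mc k = univ)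
    -- the space of ergodic components
    {M' : Type*} [MetricSpace M'] [LocallyCompactSpace M'] [TopologicalSpace.SeparableSpace M']
    [MeasurableSpace M'] [BorelSpace M']
    (π : M → M') (hπ : Continuous π) (hπinv : ∀ t : ℝ, π ∘ φ t =ᵐ[m] π)
    (p : M' → Measure M) (hp : Measurable p) (hpE : ∀ y, p y ∈ FlowForm.ergodicMeasures φ)
    (hP : FlowForm.IsRegularConditionalProbability φ m (p ∘ π)) :
    -- `ℰ^V` extends to the form domain
    (∀ u ∈ FlowForm.formDomain m S V₀ α, ∀ v ∈ FlowForm.formDomain m S V₀ α,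
      ∃! c : ℝ, FlowForm.HasFormValue m S V₀ α V u v c) ∧
    -- and the three conditions are equivalent
    ∀ u ∈ FlowForm.formDomain m S V₀ α,
      List.TFAE
        [FlowForm.IsAlmostInvariant φ m u,
         ∃ w ∈ FlowForm.contractedDomain m S V₀ α π, u =ᵐ[m] w ∘ π,
         ∀ v ∈ FlowForm.formDomain m S V₀ α, FlowForm.HasFormValue m S V₀ α V u v 0] := by
  have hlf := FlowForm.isLocallyFiniteMeasure hvol hρ hρpos
  rw [← hm] at hlf
  have hle := fun f => FlowForm.norm_sq_le_energy hvol hρ hρpos hm hS hV₀ hdiv hα f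
  have hA : ∀ f : FlowForm.testSpace n M,
      0 ≤ FlowForm.pairing (FlowForm.energyOp hS hV₀ α) f f :=
    fun f => (sq_nonneg _).trans (hle f)
  have hAA := FlowForm.qBounded_energy hS hV₀ hle (hsector₀.qBounded hS hV₀ hV₀)
  have hB := hsector.qBounded hS hV₀ hV
  refine ⟨fun u hu v hv => FlowForm.existsUnique_hasFormValue hS hV₀ hV hA hAA hB hu hv,
    fun u hu => ?_⟩
  tfae_have 1 → 2 := by
    intro hui
    obtain ⟨w, hw, huw⟩ := FlowForm.exists_factor hp (fun y => (hpE y).1) hP hinv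
      hu.1.aestronglyMeasurable hui
    have hwd := FlowForm.formDomain_congr hu huw
    exact ⟨w, ⟨(memLp_map_measure_iff hw.aestronglyMeasurable hπ.measurable.aemeasurable).2 hwd.1,
      hwd⟩, huw⟩
  tfae_have 2 → 1 := by
    rintro ⟨w, -, huw⟩ t
    refine ((hinv t).quasiMeasurePreserving.ae_eq_comp huw).trans (EventuallyEq.trans ?_ huw.symm)
    filter_upwards [hπinv t] with x hx
    exact congrArg w hx
  tfae_have 1 → 3 := fun hui v hv =>
    FlowForm.hasFormValue_zero_of_invariant hS hV₀ hV hA hB hφ hinv hu.1 hui hv.1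
  tfae_have 3 → 1 := by
    intro h3
    -- Only the functions v = h∘φ_t are needed; they belong to ℋ by `hcomp`, and the value of the
    -- form at (u, v) is the integral to be shown zero.
    refine FlowForm.isAlmostInvariant_of_integral_eq_zero hV hφ hinv hu.1 fun h hh t => ?_
    obtain ⟨f, hf⟩ := hu.2
    obtain ⟨hv, g, hg⟩ := hcomp h hh t
    exact tendsto_nhds_unique
      (FlowForm.tendsto_fieldForm_comp_flow hS hV₀ hV hA hB hφ hinv hu.1 hh t hf hg)
      (h3 _ ⟨hv, g, hg⟩ f g hf hg)
  tfae_finish
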